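/- All digraphs are finite and may have multiple arcs but no loops. Let $D=(V+x,A)$ be a digraph with $x\notin V$, where $V+x=V\cup\{x\}$, and let $k>0$ be an integer. An $x$-arborescence in $D$ is a (not necessarily spanning) subdigraph $F$ of $D$ whose underlying undirected graph is a tree and such that for every $u\in V(F)$ there is exactly one directed path in $F$ from $x$ to $u$; it is spanning if $V(F)=V+x$. For a set $B$ of arcs (a subdigraph being identified with its arc set) let $d^+_B(x)$ be the number of arcs of $B$ with tail $x$, and for $X\subseteq V$ let $d^-_B(X)$ be the number of arcs of $B$ with head in $X$ and tail outside $X$. Let $E^+(x)$ be the set of all arcs of $A$ with tail $x$. Let $\{I_1,\dots,I_l\}$ be a partition of $[k]=\{1,\dots,k\}$ into nonempty blocks, let $c'_1,\dots,c'_l$ be nonnegative integers, and let $F_1,\dots,F_k$ be pairwise arc-disjoint $x$-arborescences in $D$ such that $\sum_{i\in I_\alpha}d^+_{F_i}(x)\le c'_\alpha$ for $1\le\alpha\le l$. For $I\subseteq[k]$ and $X\subseteq V$ put $P_I(X)=\{i\in I: X\cap V(F_i)=\emptyset\}$ and $P(X)=P_{[k]}(X)$. Then there exist pairwise arc-disjoint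 spanning $x$-arborescences $F^*_1,\dots,F^*_k$ in $D$ such that $F_i$ is a subdigraph of $F^*_i$ for each $i\in[k]$ and $$\sum_{i\in I_\alpha}d^+_{F^*_i}(x)\le c'_\alpha\qquad(1\le\alpha\le l)$$ if and only if the following two conditions hold: (i) for every nonempty $X\subseteq V$, $$d^-_{A\setminus\bigcup_{i=1}^kF_i}(X)\ge|P(X)|;$$ (ii) for all pairwise disjoint nonempty sets $X_1,\dots,X_t\subseteq V$ ($t\ge0$) and every $I\subseteq[k]$ that is the union of some of $I_1,\dots,I_l$, $$\sum_{j=1}^t\Bigl(|P_I(X_j)|-d^-_{A\setminus(\bigcup_{i=1}^kF_i\cup E^+(x))}(X_j)\Bigr)\le\sum_{I_\alpha\subseteq I}\Bigl(c'_\alpha-\sum_{i\in I_\alpha}d^+_{F_i}(x)\Bigr).$$ -/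

import Mathlib

/-- A digraph with vertex type `W` and arc type `A`: multiple arcs are allowed, loops are not. -/
structure MultiDigraph (W A : Type*) where
  tail : A → W
  head : A → W
  tail_ne_head : ∀ a, tail a ≠ head a

namespace MultiDigraph

variable {W A : Type*}

/-- A subdigraph: a set of vertices and a set of arcs whose ends are among these vertices. -/
structure Subdigraph (D : MultiDigraph W A) where
  verts : Finset W
  arcs : Finset A
  tail_mem : ∀ a ∈ arcs, D.tail a ∈ verts
  head_mem : ∀ a ∈ arcs, D.head a ∈ verts

/-- `E⁺_B(v)`: the arcs of `B` with tail `v`. -/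
def outArcs [DecidableEq W] (D : MultiDigraph W A) (B : Finset A) (v : W) : Finset A :=
  B.filter (fun a => D.tail a = v)

/-- `d⁺_B(v)`: the number of arcs of `B` leaving the vertex `v`. -/
def outDegree [DecidableEq W] (D : MultiDigraph W A) (B : Finset A) (v : W) : ℕ :=
  (D.outArcs B v).card

/-- `d⁻_B(X)`: the number of arcs of `B` entering the vertex set `X`. -/
def inDegree [DecidableEq W] (D : MultiDigraph W A) (B : Finset A) (X : Finset W) : ℕ :=
  (B.filter (fun a => D.tail a ∉ X ∧ D.head a ∈ X)).card

/-- `D.IsDiwalk B u v p`: the list of arcs `p` is a directed walk from `u` to `v` in `B`. -/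
def IsDiwalk (D : MultiDigraph W A) (B : Finset A) : W → W → List A → Prop
  | u, v, [] => u = v
  | u, v, a :: p => a ∈ B ∧ D.tail a = u ∧ D.IsDiwalk B (D.head a) v p

/-- A directed path is a directed walk that repeats no vertex. -/
def IsDipath (D : MultiDigraph W A) (B : Finset A) (u v : W) (p : List A) : Prop :=
  D.IsDiwalk B u v p ∧ (u :: p.map D.head).Nodup

namespace Subdigraph

variable {D : MultiDigraph W A}

/-- The simple graph obtained by forgetting directions and multiplicities. -/
def underlying (F : D.Subdigraph) : SimpleGraph {v // v ∈ F.verts} where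
  Adj u v := ∃ a ∈ F.arcs, (D.tail a = u ∧ D.head a = v) ∨ (D.tail a = v ∧ D.head a = u)
  symm := ⟨fun _ _ ⟨a, ha, h⟩ => ⟨a, ha, h.symm⟩⟩
  loopless := ⟨fun _ ⟨a, _, h⟩ =>
    D.tail_ne_head a (h.elim (fun h => h.1.trans h.2.symm) (fun h => h.1.trans h.2.symm))⟩

/-- The underlying undirected multigraph is a tree: no two arcs (parallel or opposite) join the
same pair of vertices, and the underlying simple graph is a tree. -/
def UnderlyingIsTree (F : D.Subdigraph) : Prop :=
  (∀ a ∈ F.arcs, ∀ b ∈ F.arcs, s(D.tail a, D.head a) = s(D.tail b, D.head b) → a = b) ∧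
    F.underlying.IsTree

/-- `F` is an `r`-arborescence (not necessarily spanning). -/
def IsArborescence (F : D.Subdigraph) (r : W) : Prop :=
  r ∈ F.verts ∧ F.UnderlyingIsTree ∧ ∀ u ∈ F.verts, ∃! p : List A, D.IsDipath F.arcs r u p

def IsSpanning (F : D.Subdigraph) : Prop := ∀ v : W, v ∈ F.verts

def IsSubdigraphOf (F G : D.Subdigraph) : Prop := F.verts ⊆ G.verts ∧ F.arcs ⊆ G.arcs

def ArcDisjoint {k : ℕ} (F : Fin k → D.Subdigraph) : Prop :=
  Pairwise fun i j => Disjoint (F i).arcs (F j).arcs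

/-- `A ∖ ⋃ᵢ Fᵢ`: the arcs that no `Fᵢ` uses. -/
def freeArcs [Fintype A] [DecidableEq A] {k : ℕ} (F : Fin k → D.Subdigraph) : Finset A :=
  Finset.univ \ Finset.univ.biUnion (fun i => (F i).arcs)

/-- `A ∖ (⋃ᵢ Fᵢ ∪ E⁺(x))`: the arcs that no `Fᵢ` uses and whose tail is not `x`. -/
def freeArcsAvoiding [Fintype A] [DecidableEq W] [DecidableEq A] {k : ℕ}
    (F : Fin k → D.Subdigraph) (x : W) : Finset A :=
  Finset.univ \ (Finset.univ.biUnion (fun i => (F i).arcs) ∪ D.outArcs Finset.univ x)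

/-- `P_I(X)`: the indices `i ∈ I` such that `Fᵢ` has no vertex in `X`. -/
def missing [DecidableEq W] {k : ℕ} (F : Fin k → D.Subdigraph) (I : Finset (Fin k))
    (X : Finset W) : Finset (Fin k) :=
  I.filter (fun i => Disjoint X (F i).verts)

end Subdigraph

end MultiDigraph

/-- The sets `I₁, …, I_l` form a partition of `{1, …, k}` into nonempty blocks. -/
def IsIndexPartition {k l : ℕ} (I : Fin l → Finset (Fin k)) : Prop :=
  (∀ α, (I α).Nonempty) ∧ (Pairwise fun α β => Disjoint (I α) (I β)) ∧ ∀ i, ∃ α, i ∈ I α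

/-! Necessity is a count. If `F i` misses `X`, its spanning extension has an arc entering `X`, and
that arc is free. In (ii) those leaving `x` are new root arcs, each counted once because the sets
are disjoint.

Sufficiency separates the choice of root arcs from the extension. Give each free arc leaving `x` to
one block or to none, and split `x` into one root per block, so that `F i` yields the root set
consisting of its vertices and the root of its block. By Lovász's proof of Edmonds' theorem, a cut
condition lets these root sets grow arc by arc until they span (`CutCondition.exists_arc`,
`exists_spanning_of_cutCondition`), and `F i` then only gains root arcs given to its block.

It remains to distribute the root arcs. The cut condition asks that each rectangle `S × X` (blocks
times vertices) receive at least `demand` arcs with head in `X` and block in `S`; block `α` may take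
only its remaining capacity `c α`. Condition (i) bounds the demand by the number of free root arcs
into `X` (`ArcBound`), and (ii) bounds the total demand of a packing with rows in `T` by `c(T)`
(`PackingBound`). These bounds suffice (`exists_assignment`) because demand is supermodular for the
exchange `cross`, `hull`. Arcs are treated one at a time. An arc entering no saturated rectangle is
discarded. Otherwise it goes to a row `α` of the saturated rectangle with least row set, chosen so
that every tight packing whose rows `T` contain `α` covers the cell of `α` and the head. Such a row
exists by uncrossing tight packings (`exists_unblocked`). -/

/-! ### Uncrossing of rectangles -/

/-- A rectangle `S × X`, given by its two sides. -/
abbrev Rect (L V : Type*) := Finset L × Finset V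

namespace Rect

variable {L V : Type*} [DecidableEq L] [DecidableEq V]

/-- `z` lies below `z'` if it is narrower and taller. -/
def Below (z z' : Rect L V) : Prop := z.2 ⊆ z'.2 ∧ z'.1 ⊆ z.1

def cross (z z' : Rect L V) : Rect L V := (z.1 ∪ z'.1, z.2 ∩ z'.2)

def hull (z z' : Rect L V) : Rect L V := (z.1 ∩ z'.1, z.2 ∪ z'.2)

/-- Supermodularity on pairs of rectangles whose second sides intersect. -/
def IntersectingSupermodular (p : Rect L V → ℤ) : Prop :=
  ∀ z z' : Rect L V, (∃ w, w ∈ z.2 ∧ w ∈ z'.2) → p z + p z' ≤ p (cross z z') + p (hull z z')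

/-- Monotone along `Below`; the sum of its squares is the potential for uncrossing. -/
def rank [Fintype L] (z : Rect L V) : ℕ := z.2.card + z.1ᶜ.card

lemma rank_cross_add_rank_hull [Fintype L] (z z' : Rect L V) :
    rank (cross z z') + rank (hull z z') = rank z + rank z' := by
  have h1 := Finset.card_inter_add_card_union z.2 z'.2
  have h2 := Finset.card_inter_add_card_union z.1ᶜ z'.1ᶜ
  simp only [rank, cross, hull, Finset.compl_union, Finset.compl_inter]
  omega

lemma rank_cross_lt [Fintype L] {z z' : Rect L V} (h : ¬ Below z z') :
    rank (cross z z') < rank z := by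
  have h1 : (z.2 ∩ z'.2).card ≤ z.2.card := Finset.card_le_card Finset.inter_subset_left
  have h2 : (z.1ᶜ ∩ z'.1ᶜ).card ≤ z.1ᶜ.card := Finset.card_le_card Finset.inter_subset_left
  simp only [rank, cross, Finset.compl_union]
  by_contra hlt
  apply h
  constructor
  · have : z.2 ∩ z'.2 = z.2 := Finset.eq_of_subset_of_card_le Finset.inter_subset_left (by omega)
    exact Finset.inter_eq_left.1 this
  · have : z.1ᶜ ∩ z'.1ᶜ = z.1ᶜ :=
      Finset.eq_of_subset_of_card_le Finset.inter_subset_left (by omega)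
    exact Finset.compl_subset_compl.1 (Finset.inter_eq_left.1 this)

lemma cross_comm (z z' : Rect L V) : cross z z' = cross z' z := by
  simp [cross, Finset.union_comm, Finset.inter_comm]

/-- The exchange keeps the sum of ranks and puts the cross strictly below both originals, so the two
ranks spread apart and convexity applies. -/
lemma sq_rank_lt [Fintype L] {z z' : Rect L V} (h : ¬ Below z z') (h' : ¬ Below z' z) :
    rank z ^ 2 + rank z' ^ 2 < rank (cross z z') ^ 2 + rank (hull z z') ^ 2 := by
  have h1 := rank_cross_lt h
  have h2 := rank_cross_lt h'
  rw [cross_comm] at h2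
  have h3 := rank_cross_add_rank_hull z z'
  obtain ⟨d, hd⟩ := Nat.exists_eq_add_of_lt h1
  obtain ⟨e, he⟩ := Nat.exists_eq_add_of_lt h2
  have h4 : rank (hull z z') = rank (cross z z') + d + e + 2 := by omega
  rw [hd, he, h4]
  nlinarith [Nat.zero_le (d * e)]

-- Two packings cover a point at most twice, so multiplicities are recorded by "in one" and "in
-- both".
open Classical in
lemma or_and_of_indicator_le {P Q R S : Prop}
    (h : ((if P then 1 else 0) + (if Q then 1 else 0) : ℕ) ≤
      (if R then 1 else 0) + (if S then 1 else 0)) :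
    (P ∨ Q → R ∨ S) ∧ (P ∧ Q → R ∧ S) := by
  by_cases P <;> by_cases Q <;> by_cases R <;> by_cases S <;> simp_all

open Classical in
lemma or_and_of_indicator_eq {P Q R S : Prop}
    (h : ((if P then 1 else 0) + (if Q then 1 else 0) : ℕ) =
      (if R then 1 else 0) + (if S then 1 else 0)) :
    (P ∨ Q ↔ R ∨ S) ∧ (P ∧ Q ↔ R ∧ S) :=
  ⟨⟨(or_and_of_indicator_le h.le).1, (or_and_of_indicator_le h.ge).1⟩,
    ⟨(or_and_of_indicator_le h.le).2, (or_and_of_indicator_le h.ge).2⟩⟩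

/-- A finite family of rectangles whose second sides are nonempty and pairwise disjoint. -/
def IsPacking (𝒻 : Finset (Rect L V)) : Prop :=
  (∀ z ∈ 𝒻, z.2.Nonempty) ∧ ∀ z ∈ 𝒻, ∀ z' ∈ 𝒻, ∀ w ∈ z.2, w ∈ z'.2 → z = z'

def Covers (𝒻 : Finset (Rect L V)) (w : V) : Prop := ∃ z ∈ 𝒻, w ∈ z.2

def CoversPair (𝒻 : Finset (Rect L V)) (a : L) (w : V) : Prop := ∃ z ∈ 𝒻, a ∈ z.1 ∧ w ∈ z.2

open Classical in
lemma IsPacking.sum_covers {L V : Type*} [DecidableEq V] {𝒻 : Finset (Rect L V)} (h : IsPacking 𝒻) (w : V) :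
    ∑ z ∈ 𝒻, (if w ∈ z.2 then 1 else 0) = if Covers 𝒻 w then 1 else 0 := by
  split_ifs with hc
  · obtain ⟨z, hz, hw⟩ := hc
    rw [Finset.sum_eq_single_of_mem z hz, if_pos hw]
    intro z' hz' hne
    exact if_neg fun hw' => hne (h.2 _ hz' _ hz w hw' hw)
  · exact Finset.sum_eq_zero fun z hz => if_neg fun hw => hc ⟨z, hz, hw⟩

open Classical in
lemma IsPacking.sum_coversPair {𝒻 : Finset (Rect L V)} (h : IsPacking 𝒻) (a : L) (w : V) :
    ∑ z ∈ 𝒻, (if a ∈ z.1 ∧ w ∈ z.2 then 1 else 0) = if CoversPair 𝒻 a w then 1 else 0 := by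
  split_ifs with hc
  · obtain ⟨z, hz, hw⟩ := hc
    rw [Finset.sum_eq_single_of_mem z hz, if_pos hw]
    intro z' hz' hne
    exact if_neg fun hw' => hne (h.2 _ hz' _ hz w hw'.2 hw.2)
  · exact Finset.sum_eq_zero fun z hz => if_neg fun hw => hc ⟨z, hz, hw⟩

end Rect

lemma Finset.sum_update_update {ι β M : Type*} [DecidableEq ι] [AddCommMonoid M] (s : Finset ι)
    (f : ι → β) (φ : β → M) {i j : ι} (hi : i ∈ s) (hj : j ∈ s) (hij : i ≠ j) (y z : β) :
    ∑ t ∈ s, φ (Function.update (Function.update f i y) j z t) + (φ (f i) + φ (f j)) =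
      ∑ t ∈ s, φ (f t) + (φ y + φ z) := by
  have key : ∀ g : ι → β, ∑ t ∈ s, φ (g t) =
      ∑ t ∈ (s.erase i).erase j, φ (g t) + (φ (g i) + φ (g j)) := by
    intro g
    rw [← Finset.sum_erase_add s _ hi,
      ← Finset.sum_erase_add (s.erase i) _ (Finset.mem_erase.2 ⟨hij.symm, hj⟩), add_assoc,
      add_comm (φ (g j))]
  rw [key, key f]
  have : ∑ t ∈ (s.erase i).erase j, φ (Function.update (Function.update f i y) j z t) =
      ∑ t ∈ (s.erase i).erase j, φ (f t) := by
    refine Finset.sum_congr rfl fun t ht => ?_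
    simp only [Finset.mem_erase] at ht
    rw [Function.update_of_ne ht.1, Function.update_of_ne ht.2.1]
  rw [this, Function.update_self, Function.update_of_ne hij, Function.update_self]
  abel

namespace Rect

variable {L V : Type*} [Fintype L] [Fintype V] [DecidableEq L] [DecidableEq V]

/-- Any indexed family of rectangles can be uncrossed to one in which intersecting members are
comparable. -/
theorem exists_laminar {ι : Type*} [DecidableEq ι] {p : Rect L V → ℤ}
    (hp : IntersectingSupermodular p) (s : Finset ι) (f : ι → Rect L V)
    (hf : ∀ i ∈ s, (f i).2.Nonempty) :
    ∃ g : ι → Rect L V, (∀ i ∈ s, (g i).2.Nonempty) ∧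
      ∑ i ∈ s, p (f i) ≤ ∑ i ∈ s, p (g i) ∧
      (∀ a w, ∑ i ∈ s, (if a ∈ (g i).1 ∧ w ∈ (g i).2 then 1 else 0) ≤
        ∑ i ∈ s, (if a ∈ (f i).1 ∧ w ∈ (f i).2 then 1 else 0)) ∧
      (∀ w, ∑ i ∈ s, (if w ∈ (g i).2 then 1 else 0) =
        ∑ i ∈ s, (if w ∈ (f i).2 then 1 else 0)) ∧
      ∀ i ∈ s, ∀ j ∈ s, i ≠ j → ∀ w ∈ (g i).2, w ∈ (g j).2 →
        Below (g i) (g j) ∨ Below (g j) (g i) := by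
  -- The induction is on the gap between the potential and its trivial upper bound; every exchange
  -- narrows it.
  obtain ⟨n, hn⟩ : ∃ n, n = s.card * (Fintype.card V + Fintype.card L) ^ 2 -
    ∑ i ∈ s, rank (f i) ^ 2 := ⟨_, rfl⟩
  induction n using Nat.strong_induction_on generalizing f with
  | _ n ih =>
    by_cases hlam : ∀ i ∈ s, ∀ j ∈ s, i ≠ j → ∀ w ∈ (f i).2, w ∈ (f j).2 →
        Below (f i) (f j) ∨ Below (f j) (f i)
    · exact ⟨f, hf, le_rfl, fun _ _ => le_rfl, fun _ => rfl, hlam⟩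
    push Not at hlam
    obtain ⟨i, hi, j, hj, hij, w, hwi, hwj, hn1, hn2⟩ := hlam
    set f' := Function.update (Function.update f i (cross (f i) (f j))) j (hull (f i) (f j))
      with hf'
    have hne : ∀ t ∈ s, (f' t).2.Nonempty := by
      intro t ht
      by_cases htj : t = j
      · subst htj
        rw [hf', Function.update_self]
        exact ⟨w, by simp [hull, hwi]⟩
      rw [hf', Function.update_of_ne htj]
      by_cases hti : t = i
      · subst hti
        rw [Function.update_self]
        exact ⟨w, by simp [cross, hwi, hwj]⟩
      rw [Function.update_of_ne hti]
      exact hf t ht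
    have hbound : ∑ t ∈ s, rank (f' t) ^ 2 ≤
        s.card * (Fintype.card V + Fintype.card L) ^ 2 := by
      rw [← smul_eq_mul]
      refine Finset.sum_le_card_nsmul _ _ _ fun t _ => Nat.pow_le_pow_left ?_ 2
      exact Nat.add_le_add (Finset.card_le_univ _) (Finset.card_le_univ _)
    have hrank := Finset.sum_update_update s f (fun z => rank z ^ 2) hi hj hij
      (cross (f i) (f j)) (hull (f i) (f j))
    have hlt := sq_rank_lt hn1 hn2
    obtain ⟨g, g1, g2, g3, g4, g5⟩ := ih _ (by rw [hn]; simp only [← hf'] at hrank; omega)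
      f' hne rfl
    refine ⟨g, g1, le_trans ?_ g2, fun a w => (g3 a w).trans ?_, fun w => (g4 w).trans ?_, g5⟩
    · have h1 := Finset.sum_update_update s f p hi hj hij (cross (f i) (f j)) (hull (f i) (f j))
      have h2 := hp (f i) (f j) ⟨w, hwi, hwj⟩
      rw [← hf'] at h1
      linarith
    · have h1 := Finset.sum_update_update s f
        (fun z => if a ∈ z.1 ∧ w ∈ z.2 then 1 else 0) hi hj hij
        (cross (f i) (f j)) (hull (f i) (f j))
      have h2 : (if a ∈ (cross (f i) (f j)).1 ∧ w ∈ (cross (f i) (f j)).2 then 1 else 0) +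
          (if a ∈ (hull (f i) (f j)).1 ∧ w ∈ (hull (f i) (f j)).2 then 1 else 0) ≤
          (if a ∈ (f i).1 ∧ w ∈ (f i).2 then 1 else 0) +
          (if a ∈ (f j).1 ∧ w ∈ (f j).2 then 1 else 0) := by
        simp only [cross, hull, Finset.mem_union, Finset.mem_inter]
        by_cases c1 : a ∈ (f i).1 <;> by_cases c2 : a ∈ (f j).1 <;>
          by_cases c3 : w ∈ (f i).2 <;> by_cases c4 : w ∈ (f j).2 <;> simp [c1, c2, c3, c4]
      simp only [← hf'] at h1
      omega
    · have h1 := Finset.sum_update_update s f (fun z => if w ∈ z.2 then 1 else 0) hi hj hij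
        (cross (f i) (f j)) (hull (f i) (f j))
      have h2 : (if w ∈ (cross (f i) (f j)).2 then 1 else 0) +
          (if w ∈ (hull (f i) (f j)).2 then 1 else 0) =
          (if w ∈ (f i).2 then 1 else 0) + (if w ∈ (f j).2 then 1 else 0) := by
        simp only [cross, hull, Finset.mem_union, Finset.mem_inter]
        by_cases c3 : w ∈ (f i).2 <;> by_cases c4 : w ∈ (f j).2 <;> simp [c3, c4]
      simp only [← hf'] at h1
      omega

open Classical in
/-- Two packings can be uncrossed into two packings `𝒜` (the wide rectangles) and `ℬ`. -/
theorem exists_uncrossing {p : Rect L V → ℤ} (hp : IntersectingSupermodular p)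
    {𝒻 𝒢 : Finset (Rect L V)} (h𝒻 : IsPacking 𝒻) (h𝒢 : IsPacking 𝒢) {K : Finset L}
    (hK : ∀ z ∈ 𝒻, ∀ z' ∈ 𝒢, z.1 ∩ z'.1 ⊆ K) :
    ∃ 𝒜 ℬ : Finset (Rect L V), IsPacking 𝒜 ∧ IsPacking ℬ ∧
      ∑ z ∈ 𝒻, p z + ∑ z ∈ 𝒢, p z ≤ ∑ z ∈ 𝒜, p z + ∑ z ∈ ℬ, p z ∧
      (∀ z ∈ 𝒜, z.1 ⊆ K) ∧
      (∀ w, (Covers 𝒻 w ∨ Covers 𝒢 w ↔ Covers 𝒜 w ∨ Covers ℬ w) ∧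
        (Covers 𝒻 w ∧ Covers 𝒢 w ↔ Covers 𝒜 w ∧ Covers ℬ w)) ∧
      (∀ a w, (CoversPair 𝒜 a w ∨ CoversPair ℬ a w → CoversPair 𝒻 a w ∨ CoversPair 𝒢 a w) ∧
        (CoversPair 𝒜 a w ∧ CoversPair ℬ a w → CoversPair 𝒻 a w ∧ CoversPair 𝒢 a w)) ∧
      (∀ z ∈ 𝒜, ∀ z' ∈ ℬ, ∀ w ∈ z.2, w ∈ z'.2 → z.1 ⊆ z'.1) ∧
      (∀ z ∈ ℬ, z.1 ⊆ K → ∀ w ∈ z.2, Covers 𝒜 w) := by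
  -- The disjoint sum keeps two copies of a rectangle lying in both packings.
  set s : Finset (Rect L V ⊕ Rect L V) := 𝒻.disjSum 𝒢 with hs
  obtain ⟨g, hne, hsum, hpair, hcov, hlam⟩ := exists_laminar hp s (Sum.elim id id) (by
    intro i hi
    rw [hs, Finset.mem_disjSum] at hi
    rcases hi with ⟨z, hz, rfl⟩ | ⟨z, hz, rfl⟩
    · exact h𝒻.1 z hz
    · exact h𝒢.1 z hz)
  replace hsum : ∑ z ∈ 𝒻, p z + ∑ z ∈ 𝒢, p z ≤ ∑ i ∈ s, p (g i) := by
    rw [hs, Finset.sum_disjSum] at hsum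
    exact hsum
  replace hcov : ∀ w, ∑ i ∈ s, (if w ∈ (g i).2 then 1 else 0) =
      (if Covers 𝒻 w then 1 else 0) + (if Covers 𝒢 w then 1 else 0) := by
    intro w
    rw [hcov w, hs, Finset.sum_disjSum]
    exact congrArg₂ (· + ·) (h𝒻.sum_covers w) (h𝒢.sum_covers w)
  replace hpair : ∀ a w, ∑ i ∈ s, (if a ∈ (g i).1 ∧ w ∈ (g i).2 then 1 else 0) ≤
      (if CoversPair 𝒻 a w then 1 else 0) + (if CoversPair 𝒢 a w then 1 else 0) := by
    intro a w
    refine (hpair a w).trans_eq ?_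
    rw [hs, Finset.sum_disjSum]
    exact congrArg₂ (· + ·) (h𝒻.sum_coversPair a w) (h𝒢.sum_coversPair a w)
  -- The numbering breaks ties between equal rectangles, so that `Lt` orders any two intersecting
  -- members.
  obtain ⟨r, hr⟩ : ∃ r : Rect L V ⊕ Rect L V → ℕ, Function.Injective r :=
    ⟨fun i => Fintype.equivFin _ i, fun i j h => (Fintype.equivFin _).injective (Fin.ext h)⟩
  let Lt : Rect L V ⊕ Rect L V → Rect L V ⊕ Rect L V → Prop := fun i j =>
    i ∈ s ∧ j ∈ s ∧ i ≠ j ∧ Below (g i) (g j) ∧ (Below (g j) (g i) → r i < r j)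
  have hLt_total : ∀ i ∈ s, ∀ j ∈ s, i ≠ j → ∀ w ∈ (g i).2, w ∈ (g j).2 → Lt i j ∨ Lt j i := by
    intro i hi j hj hij w hwi hwj
    have hr' : r i ≠ r j := fun h => hij (hr h)
    by_cases h1 : Below (g i) (g j) <;> by_cases h2 : Below (g j) (g i)
    · rcases lt_or_gt_of_ne hr' with h | h
      · exact Or.inl ⟨hi, hj, hij, h1, fun _ => h⟩
      · exact Or.inr ⟨hj, hi, hij.symm, h2, fun _ => h⟩
    · exact Or.inl ⟨hi, hj, hij, h1, fun h => (h2 h).elim⟩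
    · exact Or.inr ⟨hj, hi, hij.symm, h2, fun h => (h1 h).elim⟩
    · exact ((hlam i hi j hj hij w hwi hwj).elim h1 h2).elim
  -- A chain of three would cover a vertex three times.
  have hLt_chain : ∀ i j k, Lt i j → Lt j k → False := by
    rintro i j k ⟨hi, hj, hij, h1, h2⟩ ⟨-, hk, hjk, h3, h4⟩
    have hik : i ≠ k := by
      rintro rfl
      exact absurd (h2 h3) (not_lt.2 (h4 h1).le)
    obtain ⟨w, hw⟩ := hne i hi
    have h3card : ∑ t ∈ ({i, j, k} : Finset _), (if w ∈ (g t).2 then 1 else 0) = 3 := by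
      rw [Finset.sum_insert (by simp [hij, hik]), Finset.sum_insert (by simp [hjk]),
        Finset.sum_singleton, if_pos hw, if_pos (h1.1 hw), if_pos (h3.1 (h1.1 hw))]
      rfl
    have hle : ∑ t ∈ ({i, j, k} : Finset _), (if w ∈ (g t).2 then 1 else 0) ≤
        ∑ t ∈ s, (if w ∈ (g t).2 then 1 else 0) := by
      refine Finset.sum_le_sum_of_subset ?_
      intro t ht
      simp only [Finset.mem_insert, Finset.mem_singleton] at ht
      rcases ht with rfl | rfl | rfl <;> assumption
    rw [hcov w, h3card] at hle
    split_ifs at hle <;> omega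
  -- A row of the upper member and a vertex of the lower one form a cell covered twice, hence
  -- covered by both original packings.
  have hLt_K : ∀ i j, Lt i j → (g j).1 ⊆ K := by
    rintro i j ⟨hi, hj, hij, h1, -⟩ a ha
    obtain ⟨w, hw⟩ := hne i hi
    have h2card : ∑ t ∈ ({i, j} : Finset _), (if a ∈ (g t).1 ∧ w ∈ (g t).2 then 1 else 0)
        = 2 := by
      rw [Finset.sum_insert (by simp [hij]), Finset.sum_singleton, if_pos ⟨h1.2 ha, hw⟩,
        if_pos ⟨ha, h1.1 hw⟩]
    have hle : ∑ t ∈ ({i, j} : Finset _), (if a ∈ (g t).1 ∧ w ∈ (g t).2 then 1 else 0) ≤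
        ∑ t ∈ s, (if a ∈ (g t).1 ∧ w ∈ (g t).2 then 1 else 0) := by
      refine Finset.sum_le_sum_of_subset ?_
      intro t ht
      simp only [Finset.mem_insert, Finset.mem_singleton] at ht
      rcases ht with rfl | rfl <;> assumption
    have := hpair a w
    rw [h2card] at hle
    split_ifs at this with c1 c2
    · obtain ⟨z, hz, hz1, -⟩ := c1
      obtain ⟨z', hz', hz1', -⟩ := c2
      exact hK z hz z' hz' (Finset.mem_inter.2 ⟨hz1, hz1'⟩)
    all_goals omega
  -- `𝒜` takes the maximal members with rows in `K`. Since chains have length at most two and every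
  -- upper member has rows in `K`, both classes are packings.
  let Q : Rect L V ⊕ Rect L V → Prop := fun i => (¬ ∃ j, Lt i j) ∧ (g i).1 ⊆ K
  have hQ_of_Lt : ∀ i j, Lt i j → Q j := fun i j h =>
    ⟨fun ⟨k, hk⟩ => hLt_chain i j k h hk, hLt_K i j h⟩
  have hAinj : ∀ i ∈ s.filter Q, ∀ j ∈ s.filter Q, ∀ w ∈ (g i).2, w ∈ (g j).2 → i = j := by
    intro i hi j hj w hwi hwj
    rw [Finset.mem_filter] at hi hj
    by_contra hij
    rcases hLt_total i hi.1 j hj.1 hij w hwi hwj with h | h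
    · exact hi.2.1 ⟨_, h⟩
    · exact hj.2.1 ⟨_, h⟩
  have hBinj : ∀ i ∈ s.filter (¬ Q ·), ∀ j ∈ s.filter (¬ Q ·), ∀ w ∈ (g i).2, w ∈ (g j).2 →
      i = j := by
    intro i hi j hj w hwi hwj
    rw [Finset.mem_filter] at hi hj
    by_contra hij
    rcases hLt_total i hi.1 j hj.1 hij w hwi hwj with h | h
    · exact hj.2 (hQ_of_Lt _ _ h)
    · exact hi.2 (hQ_of_Lt _ _ h)
  have himage : ∀ t : Finset (Rect L V ⊕ Rect L V), t ⊆ s →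
      (∀ i ∈ t, ∀ j ∈ t, ∀ w ∈ (g i).2, w ∈ (g j).2 → i = j) →
      IsPacking (t.image g) ∧ Set.InjOn g t := by
    intro t hts h
    refine ⟨⟨?_, ?_⟩, ?_⟩
    · simp only [Finset.mem_image]
      rintro _ ⟨i, hi, rfl⟩
      exact hne i (hts hi)
    · simp only [Finset.mem_image]
      rintro _ ⟨i, hi, rfl⟩ _ ⟨j, hj, rfl⟩ w hw hw'
      rw [h i hi j hj w hw hw']
    · intro i hi j hj hij
      obtain ⟨w, hw⟩ := hne i (hts hi)
      exact h i hi j hj w hw (hij ▸ hw)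
  obtain ⟨hA, hAi⟩ := himage _ (Finset.filter_subset _ _) hAinj
  obtain ⟨hB, hBi⟩ := himage _ (Finset.filter_subset _ _) hBinj
  refine ⟨_, _, hA, hB, ?_, ?_, ?_, ?_, ?_, ?_⟩
  · rw [Finset.sum_image hAi, Finset.sum_image hBi, Finset.sum_filter_add_sum_filter_not]
    exact hsum
  · simp only [Finset.mem_image, Finset.mem_filter]
    rintro _ ⟨i, ⟨-, hi⟩, rfl⟩
    exact hi.2
  · intro w
    have h1 := hA.sum_covers w
    have h2 := hB.sum_covers w
    have h3 := hcov w
    rw [Finset.sum_image hAi] at h1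
    rw [Finset.sum_image hBi] at h2
    rw [← Finset.sum_filter_add_sum_filter_not s Q, h1, h2] at h3
    exact or_and_of_indicator_eq h3.symm
  · intro a w
    have h1 := hA.sum_coversPair a w
    have h2 := hB.sum_coversPair a w
    have h3 := hpair a w
    rw [Finset.sum_image hAi] at h1
    rw [Finset.sum_image hBi] at h2
    rw [← Finset.sum_filter_add_sum_filter_not s Q, h1, h2] at h3
    exact or_and_of_indicator_le h3
  · simp only [Finset.mem_image, Finset.mem_filter]
    rintro _ ⟨i, ⟨hi, hQi⟩, rfl⟩ _ ⟨j, ⟨hj, hQj⟩, rfl⟩ w hwi hwj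
    have hij : i ≠ j := by
      rintro rfl
      exact hQj hQi
    rcases hLt_total i hi j hj hij w hwi hwj with h | h
    · exact (hQi.1 ⟨_, h⟩).elim
    · exact h.2.2.2.1.2
  · simp only [Finset.mem_image, Finset.mem_filter]
    rintro _ ⟨i, ⟨hi, hQi⟩, rfl⟩ hiK w hw
    obtain ⟨j, hj⟩ : ∃ j, Lt i j := by
      by_contra h
      exact hQi ⟨h, hiK⟩
    exact ⟨g j, Finset.mem_image.2 ⟨j, Finset.mem_filter.2 ⟨hj.2.1, hQ_of_Lt _ _ hj⟩, rfl⟩,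
      hj.2.2.2.1.1 hw⟩

end Rect

/-! ### Tight packings and their uncrossing -/

namespace Rect

variable {L V : Type*} [Fintype L] [Fintype V] [DecidableEq L] [DecidableEq V]

/-- The value of `p` on every packing of rectangles within the rows `T` is at most `c(T)`. -/
def PackingBound (p : Rect L V → ℤ) (c : L → ℤ) : Prop :=
  ∀ (𝒻 : Finset (Rect L V)) (T : Finset L), IsPacking 𝒻 → (∀ z ∈ 𝒻, z.1 ⊆ T) →
    ∑ z ∈ 𝒻, p z ≤ ∑ a ∈ T, c a

/-- Under `PackingBound` the inequality is an equality. -/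
def IsTight (p : Rect L V → ℤ) (c : L → ℤ) (T : Finset L) (𝒻 : Finset (Rect L V)) : Prop :=
  IsPacking 𝒻 ∧ (∀ z ∈ 𝒻, z.1 ⊆ T) ∧ ∑ a ∈ T, c a ≤ ∑ z ∈ 𝒻, p z

/-- Some tight packing for `T` leaves `v` uncovered. -/
def TightAvoiding (p : Rect L V → ℤ) (c : L → ℤ) (v : V) (T : Finset L) : Prop :=
  ∃ 𝒻, IsTight p c T 𝒻 ∧ ¬ Covers 𝒻 v

/-- Some tight packing for `T` covers `v` by a rectangle with first side `N`. -/
def TightCovering (p : Rect L V → ℤ) (c : L → ℤ) (v : V) (T N : Finset L) : Prop :=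
  ∃ 𝒻, IsTight p c T 𝒻 ∧ ∃ z ∈ 𝒻, z.1 = N ∧ v ∈ z.2

variable {p : Rect L V → ℤ} {c : L → ℤ} {v : V} {T T' N N' : Finset L}

lemma IsPacking.coversPair_of_covers {L V : Type*} {𝒻 : Finset (Rect L V)} (h : IsPacking 𝒻)
    {z : Rect L V} (hz : z ∈ 𝒻) {a : L} {w : V} (hw : w ∈ z.2) (ha : CoversPair 𝒻 a w) :
    a ∈ z.1 := by
  obtain ⟨z', hz', ha', hw'⟩ := ha
  rwa [h.2 z hz z' hz' w hw hw']

/-- Uncrossing two tight packings gives tight packings for the intersection and the union. -/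
theorem IsTight.uncross (hp : IntersectingSupermodular p) (hc : PackingBound p c)
    {𝒻 𝒢 : Finset (Rect L V)} (h𝒻 : IsTight p c T 𝒻) (h𝒢 : IsTight p c T' 𝒢) :
    ∃ 𝒜 ℬ : Finset (Rect L V), IsTight p c (T ∩ T') 𝒜 ∧ IsTight p c (T ∪ T') ℬ ∧
      (∀ w, (Covers 𝒻 w ∨ Covers 𝒢 w ↔ Covers 𝒜 w ∨ Covers ℬ w) ∧
        (Covers 𝒻 w ∧ Covers 𝒢 w ↔ Covers 𝒜 w ∧ Covers ℬ w)) ∧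
      (∀ a w, (CoversPair 𝒜 a w ∨ CoversPair ℬ a w → CoversPair 𝒻 a w ∨ CoversPair 𝒢 a w) ∧
        (CoversPair 𝒜 a w ∧ CoversPair ℬ a w → CoversPair 𝒻 a w ∧ CoversPair 𝒢 a w)) ∧
      (∀ z ∈ 𝒜, ∀ z' ∈ ℬ, ∀ w ∈ z.2, w ∈ z'.2 → z.1 ⊆ z'.1) ∧
      (∀ z ∈ ℬ, z.1 ⊆ T ∩ T' → ∀ w ∈ z.2, Covers 𝒜 w) := by
  obtain ⟨𝒜, ℬ, hA, hB, hsum, hAK, hcov, hpair, hnest, hBK⟩ :=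
    exists_uncrossing hp h𝒻.1 h𝒢.1 (K := T ∩ T')
      fun z hz z' hz' => Finset.inter_subset_inter (h𝒻.2.1 z hz) (h𝒢.2.1 z' hz')
  have hBT : ∀ z ∈ ℬ, z.1 ⊆ T ∪ T' := by
    intro z hz a ha
    obtain ⟨w, hw⟩ := hB.1 z hz
    rcases (hpair a w).1 (Or.inr ⟨z, hz, ha, hw⟩) with ⟨y, hy, hay, -⟩ | ⟨y, hy, hay, -⟩
    · exact Finset.mem_union_left _ (h𝒻.2.1 y hy hay)
    · exact Finset.mem_union_right _ (h𝒢.2.1 y hy hay)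
  have h1 := hc 𝒜 _ hA hAK
  have h2 := hc ℬ _ hB hBT
  have h3 := Finset.sum_union_inter (s₁ := T) (s₂ := T') (f := c)
  have h4 := h𝒻.2.2
  have h5 := h𝒢.2.2
  exact ⟨𝒜, ℬ, ⟨hA, hAK, by linarith⟩, ⟨hB, hBT, by linarith⟩, hcov, hpair, hnest, hBK⟩

lemma TightAvoiding.union (hp : IntersectingSupermodular p) (hc : PackingBound p c)
    (h : TightAvoiding p c v T) (h' : TightAvoiding p c v T') :
    TightAvoiding p c v (T ∪ T') := by
  obtain ⟨𝒻, h𝒻, hv⟩ := h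
  obtain ⟨𝒢, h𝒢, hv'⟩ := h'
  obtain ⟨𝒜, ℬ, -, hB, hcov, -⟩ := h𝒻.uncross hp hc h𝒢
  exact ⟨ℬ, hB, fun h => ((hcov v).1.2 (Or.inr h)).elim hv hv'⟩

/-- A rectangle of `ℬ` over `v` takes its rows from `N`, hence from `T ∩ T'`. Then `𝒜` covers `v`
too, and a double cover would force `𝒢` to cover `v`. -/
lemma TightCovering.union_avoiding (hp : IntersectingSupermodular p) (hc : PackingBound p c)
    (h : TightCovering p c v T N) (h' : TightAvoiding p c v T') (hN : N ⊆ T') :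
    TightAvoiding p c v (T ∪ T') := by
  obtain ⟨𝒻, h𝒻, y, hy, rfl, hvy⟩ := h
  obtain ⟨𝒢, h𝒢, hv'⟩ := h'
  obtain ⟨𝒜, ℬ, -, hB, hcov, hpair, -, hBK⟩ := h𝒻.uncross hp hc h𝒢
  refine ⟨ℬ, hB, fun ⟨z, hz, hvz⟩ => ?_⟩
  have hzK : z.1 ⊆ T ∩ T' := by
    intro a ha
    rcases (hpair a v).1 (Or.inr ⟨z, hz, ha, hvz⟩) with h | ⟨y', hy', -, hvy'⟩
    · have := h𝒻.1.coversPair_of_covers hy hvy h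
      exact Finset.mem_inter.2 ⟨h𝒻.2.1 y hy this, hN this⟩
    · exact (hv' ⟨y', hy', hvy'⟩).elim
  exact hv' ((hcov v).2.2 ⟨hBK z hz hzK v hvz, z, hz, hvz⟩).2

/-- Here `v` is covered twice, so both `𝒜` and `ℬ` cover it. By nesting, each row of the
`𝒜`-rectangle gives a doubly covered cell, which lies in both originals. -/
lemma TightCovering.inter (hp : IntersectingSupermodular p) (hc : PackingBound p c)
    (h : TightCovering p c v T N) (h' : TightCovering p c v T' N') :
    ∃ M ⊆ N ∩ N', TightCovering p c v (T ∩ T') M := by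
  obtain ⟨𝒻, h𝒻, y, hy, rfl, hvy⟩ := h
  obtain ⟨𝒢, h𝒢, y', hy', rfl, hvy'⟩ := h'
  obtain ⟨𝒜, ℬ, hA, hB, hcov, hpair, hnest, hBK⟩ := h𝒻.uncross hp hc h𝒢
  obtain ⟨⟨z, hz, hvz⟩, ⟨z', hz', hvz'⟩⟩ := (hcov v).2.1 ⟨⟨y, hy, hvy⟩, ⟨y', hy', hvy'⟩⟩
  refine ⟨z.1, fun a ha => ?_, 𝒜, hA, z, hz, rfl, hvz⟩
  obtain ⟨h1, h2⟩ := (hpair a v).2 ⟨⟨z, hz, ha, hvz⟩, ⟨z', hz', hnest z hz z' hz' v hvz hvz' ha, hvz'⟩⟩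
  exact Finset.mem_inter.2
    ⟨h𝒻.1.coversPair_of_covers hy hvy h1, h𝒢.1.coversPair_of_covers hy' hvy' h2⟩

lemma isPacking_singleton {L V : Type*} {z : Rect L V} (hz : z.2.Nonempty) : IsPacking {z} := by
  refine ⟨fun y hy => ?_, fun y hy y' hy' _ _ _ => ?_⟩
  · rw [Finset.mem_singleton] at hy
    rwa [hy]
  · rw [Finset.mem_singleton] at hy hy'
    rw [hy, hy']

/-! ### Distributing arcs among rows -/

section Arcs

variable {A : Type*} {U : Finset A} {h : A → V}

/-- Every rectangle has at most as much demand as there are arcs into its second side. -/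
def ArcBound (p : Rect L V → ℤ) (U : Finset A) (h : A → V) : Prop :=
  ∀ z : Rect L V, z.2.Nonempty → p z ≤ ((U.filter (fun a => h a ∈ z.2)).card : ℤ)

/-- Uncrossing a tight packing with a rectangle that meets its arc bound with equality. -/
theorem IsTight.uncross_rect (hp : IntersectingSupermodular p) (hc : PackingBound p c)
    (hU : ArcBound p U h) {z₀ : Rect L V} (hz₀ : z₀.2.Nonempty)
    (htight : ((U.filter (fun a => h a ∈ z₀.2)).card : ℤ) ≤ p z₀)
    {𝒻 : Finset (Rect L V)} (h𝒻 : IsTight p c T 𝒻) :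
    ∃ 𝒜 ℬ : Finset (Rect L V), IsTight p c T 𝒜 ∧ IsPacking ℬ ∧
      (∀ a ∈ U, h a ∈ z₀.2 → Covers ℬ (h a)) ∧
      (∀ w, (Covers 𝒻 w ∨ w ∈ z₀.2 ↔ Covers 𝒜 w ∨ Covers ℬ w) ∧
        (Covers 𝒻 w ∧ w ∈ z₀.2 ↔ Covers 𝒜 w ∧ Covers ℬ w)) ∧
      (∀ a w, (CoversPair 𝒜 a w ∨ CoversPair ℬ a w →
          CoversPair 𝒻 a w ∨ a ∈ z₀.1 ∧ w ∈ z₀.2) ∧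
        (CoversPair 𝒜 a w ∧ CoversPair ℬ a w → CoversPair 𝒻 a w ∧ a ∈ z₀.1 ∧ w ∈ z₀.2)) ∧
      (∀ z ∈ 𝒜, ∀ z' ∈ ℬ, ∀ w ∈ z.2, w ∈ z'.2 → z.1 ⊆ z'.1) ∧
      (∀ z ∈ ℬ, z.1 ⊆ T → ∀ w ∈ z.2, Covers 𝒜 w) := by
  classical
  obtain ⟨𝒜, ℬ, hA, hB, hsum, hAK, hcov, hpair, hnest, hBK⟩ :=
    exists_uncrossing hp h𝒻.1 (isPacking_singleton hz₀) (K := T)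
      fun z hz z' hz' => Finset.inter_subset_left.trans (h𝒻.2.1 z hz)
  have hcs : ∀ w, Covers {z₀} w ↔ w ∈ z₀.2 := by simp [Covers]
  have hps : ∀ a w, CoversPair {z₀} a w ↔ a ∈ z₀.1 ∧ w ∈ z₀.2 := by simp [CoversPair]
  simp only [hcs, hps] at hcov hpair
  -- If the rows lie in `T`, the vertex is covered twice, hence by `z₀`; otherwise a row outside `T`
  -- can only come from `z₀`.
  have hBz : ∀ z ∈ ℬ, z.2 ⊆ z₀.2 := by
    intro z hz w hw
    by_cases hzT : z.1 ⊆ T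
    · exact ((hcov w).2.2 ⟨hBK z hz hzT w hw, z, hz, hw⟩).2
    · obtain ⟨a, ha, haT⟩ := Finset.not_subset.1 hzT
      rcases (hpair a w).1 (Or.inr ⟨z, hz, ha, hw⟩) with ⟨y, hy, hay, -⟩ | h
      · exact (haT (h𝒻.2.1 y hy hay)).elim
      · exact h.2
  have hBsum : ∑ z ∈ ℬ, p z ≤ ((ℬ.biUnion fun z => U.filter (fun a => h a ∈ z.2)).card : ℤ) := by
    rw [Finset.card_biUnion]
    · push_cast
      exact Finset.sum_le_sum fun z hz => hU z (hB.1 z hz)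
    · intro z hz z' hz' hne
      refine Finset.disjoint_left.2 ?_
      intro a ha ha'
      rw [Finset.mem_filter] at ha ha'
      exact hne (hB.2 z hz z' hz' _ ha.2 ha'.2)
  have hsub : (ℬ.biUnion fun z => U.filter (fun a => h a ∈ z.2)) ⊆
      U.filter (fun a => h a ∈ z₀.2) := by
    intro a ha
    simp only [Finset.mem_biUnion, Finset.mem_filter] at ha ⊢
    obtain ⟨z, hz, haU, hza⟩ := ha
    exact ⟨haU, hBz z hz hza⟩
  have h1 := hc 𝒜 _ hA hAK
  have h2 := h𝒻.2.2
  have h3 : ((ℬ.biUnion fun z => U.filter (fun a => h a ∈ z.2)).card : ℤ) ≤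
      ((U.filter (fun a => h a ∈ z₀.2)).card : ℤ) := by
    exact_mod_cast Finset.card_le_card hsub
  rw [Finset.sum_singleton] at hsum
  -- The packing bound for `𝒜` and the arc bounds for `ℬ` are forced to be equalities, so `ℬ`
  -- catches every arc into `z₀.2`.
  have heq := Finset.eq_of_subset_of_card_le hsub (by
    have : ((U.filter (fun a => h a ∈ z₀.2)).card : ℤ) ≤
      ((ℬ.biUnion fun z => U.filter (fun a => h a ∈ z.2)).card : ℤ) := by linarith
    exact_mod_cast this)
  refine ⟨𝒜, ℬ, ⟨hA, hAK, by linarith⟩, hB, ?_, hcov, hpair, hnest, hBK⟩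
  intro a ha haz
  have : a ∈ ℬ.biUnion fun z => U.filter (fun a => h a ∈ z.2) := by
    rw [heq]
    exact Finset.mem_filter.2 ⟨ha, haz⟩
  simp only [Finset.mem_biUnion, Finset.mem_filter] at this
  obtain ⟨z, hz, -, hza⟩ := this
  exact ⟨z, hz, hza⟩

/-- Otherwise the `ℬ`-rectangle over `h e`, whose rows all come from `z₀`, has rows in `T`; then `𝒜`
covers `h e` as well, and so does the avoiding packing. -/
lemma TightAvoiding.not_subset (hp : IntersectingSupermodular p) (hc : PackingBound p c)
    (hU : ArcBound p U h) {z₀ : Rect L V} {e : A} (he : e ∈ U) (hez : h e ∈ z₀.2)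
    (htight : ((U.filter (fun a => h a ∈ z₀.2)).card : ℤ) ≤ p z₀)
    (hT : TightAvoiding p c (h e) T) : ¬ z₀.1 ⊆ T := by
  obtain ⟨𝒻, h𝒻, hv⟩ := hT
  obtain ⟨𝒜, ℬ, hA, hB, hcovU, hcov, hpair, hnest, hBK⟩ :=
    h𝒻.uncross_rect hp hc hU ⟨_, hez⟩ htight
  intro hsub
  obtain ⟨z, hz, hvz⟩ := hcovU e he hez
  refine hv ((hcov (h e)).2.2 ⟨hBK z hz (fun a ha => ?_) _ hvz, z, hz, hvz⟩).1
  rcases (hpair a (h e)).1 (Or.inr ⟨z, hz, ha, hvz⟩) with ⟨y, hy, -, hvy⟩ | h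
  · exact (hv ⟨y, hy, hvy⟩).elim
  · exact hsub h.1

/-- Allows the covering rectangle to be taken with rows inside `z₀`, where every row is assumed
blocked. -/
lemma TightCovering.inter_rect (hp : IntersectingSupermodular p) (hc : PackingBound p c)
    (hU : ArcBound p U h) {z₀ : Rect L V} {e : A} (hez : h e ∈ z₀.2)
    (htight : ((U.filter (fun a => h a ∈ z₀.2)).card : ℤ) ≤ p z₀)
    (hT : TightCovering p c (h e) T N) : ∃ M ⊆ N ∩ z₀.1, TightCovering p c (h e) T M := by
  obtain ⟨𝒻, h𝒻, y, hy, rfl, hvy⟩ := hT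
  obtain ⟨𝒜, ℬ, hA, hB, hcovU, hcov, hpair, hnest, hBK⟩ :=
    h𝒻.uncross_rect hp hc hU ⟨_, hez⟩ htight
  obtain ⟨⟨z, hz, hvz⟩, ⟨z', hz', hvz'⟩⟩ := (hcov (h e)).2.1 ⟨⟨y, hy, hvy⟩, hez⟩
  refine ⟨z.1, fun a ha => ?_, 𝒜, hA, z, hz, rfl, hvz⟩
  obtain ⟨h1, h2⟩ := (hpair a (h e)).2
    ⟨⟨z, hz, ha, hvz⟩, ⟨z', hz', hnest z hz z' hz' _ hvz hvz' ha, hvz'⟩⟩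
  exact Finset.mem_inter.2 ⟨h𝒻.1.coversPair_of_covers hy hvy h1, h2.1⟩

/-- Some row of a tight rectangle is not blocked by tight packings. -/
theorem exists_unblocked (hp : IntersectingSupermodular p) (hc : PackingBound p c)
    (hU : ArcBound p U h) {z₀ : Rect L V} {e : A} (he : e ∈ U) (hez : h e ∈ z₀.2)
    (htight : ((U.filter (fun a => h a ∈ z₀.2)).card : ℤ) ≤ p z₀) :
    ∃ α ∈ z₀.1, ∀ T 𝒻, IsTight p c T 𝒻 → α ∈ T → CoversPair 𝒻 α (h e) := by
  classical
  by_contra hbad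
  push Not at hbad
  have hbad' : ∀ α ∈ z₀.1, (∃ T, α ∈ T ∧ TightAvoiding p c (h e) T) ∨
      ∃ T N, α ∈ T ∧ α ∉ N ∧ TightCovering p c (h e) T N := by
    intro α hα
    obtain ⟨T, 𝒻, h𝒻, hαT, hcp⟩ := hbad α hα
    by_cases hv : Covers 𝒻 (h e)
    · obtain ⟨z, hz, hvz⟩ := hv
      exact Or.inr ⟨T, z.1, hαT, fun hαz => hcp ⟨z, hz, hαz, hvz⟩, 𝒻, h𝒻, z, hz, rfl, hvz⟩
    · exact Or.inl ⟨T, hαT, 𝒻, h𝒻, hv⟩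
  -- Avoiding row sets are closed under union, so there is a largest one.
  obtain ⟨T₁, hT₁, hmax⟩ : ∃ T₁, TightAvoiding p c (h e) T₁ ∧
      ∀ T, TightAvoiding p c (h e) T → T ⊆ T₁ := by
    have hempty : TightAvoiding p c (h e) ∅ :=
      ⟨∅, ⟨⟨by simp, by simp⟩, by simp, by simp⟩, by simp [Covers]⟩
    obtain ⟨T₁, hT₁, hmax⟩ := Finset.exists_max_image
      (Finset.univ.filter (fun T => TightAvoiding p c (h e) T)) Finset.card
      ⟨∅, by simpa using hempty⟩
    simp only [Finset.mem_filter, Finset.mem_univ, true_and] at hT₁ hmax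
    refine ⟨T₁, hT₁, fun T hT => ?_⟩
    have := Finset.eq_of_subset_of_card_le (Finset.subset_union_right (s₁ := T))
      (hmax _ (hT.union hp hc hT₁))
    rw [this]
    exact Finset.subset_union_left
  obtain ⟨α, hα, hαT₁⟩ := Finset.not_subset.1 (hT₁.not_subset hp hc hU he hez htight)
  have hcover : ∀ β ∈ z₀.1, β ∉ T₁ →
      ∃ T N, β ∈ T ∧ β ∉ N ∧ TightCovering p c (h e) T N := by
    intro β hβ hβT
    rcases hbad' β hβ with ⟨T, hT, hav⟩ | h
    · exact (hβT (hmax T hav hT)).elim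
    · exact h
  -- Infinite descent: if `N ⊆ T₁`, then `T ∪ T₁` would avoid `h e`, against maximality. So some `γ
  -- ∈ N` lies outside `T₁`, and intersecting with the packing that blocks `γ` removes `γ` from `N`.
  have key : ∀ n : ℕ, ∀ T N : Finset L, T.card + N.card = n → TightCovering p c (h e) T N →
      N ⊆ z₀.1 → ∀ β ∈ z₀.1, β ∉ T₁ → β ∈ T → β ∉ N → False := by
    intro n
    induction n using Nat.strong_induction_on with
    | _ n ih =>
      intro T N hn hTN hN β hβ hβT₁ hβT hβN
      obtain ⟨γ, hγN, hγT₁⟩ := Finset.not_subset.1 fun hNT₁ =>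
        hβT₁ (hmax _ (hTN.union_avoiding hp hc hT₁ hNT₁) (Finset.mem_union_left _ hβT))
      have hγT : γ ∈ T := by
        obtain ⟨𝒻, h𝒻, z, hz, rfl, -⟩ := hTN
        exact h𝒻.2.1 z hz hγN
      obtain ⟨T', N', hγT', hγN', hTN'⟩ := hcover γ (hN hγN) hγT₁
      obtain ⟨M, hM, hTM⟩ := hTN.inter hp hc hTN'
      have hMN : M ⊆ N := hM.trans Finset.inter_subset_left
      have hγM : γ ∉ M := fun hγ => hγN' (Finset.mem_inter.1 (hM hγ)).2
      have h1 : M.card < N.card := Finset.card_lt_card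
        ⟨hMN, fun hsub => hγM (hsub hγN)⟩
      have h2 : (T ∩ T').card ≤ T.card := Finset.card_le_card Finset.inter_subset_left
      exact ih _ (by omega) _ M rfl hTM (hMN.trans hN) γ (hN hγN) hγT₁
        (Finset.mem_inter.2 ⟨hγT, hγT'⟩) hγM
  obtain ⟨T, N, hαT, hαN, hTN⟩ := hcover α hα hαT₁
  obtain ⟨M, hM, hTM⟩ := hTN.inter_rect hp hc hU hez htight
  exact key _ T M rfl hTM (hM.trans Finset.inter_subset_right) α hα hαT₁ hαT
    fun h => hαN (Finset.mem_inter.1 (hM h)).1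

/-- Among the rectangles that meet their arc bound at `e`, one has the fewest rows. -/
lemma exists_least_tight (hp : IntersectingSupermodular p) (hU : ArcBound p U h) {e : A}
    (hex : ∃ z : Rect L V, h e ∈ z.2 ∧ ((U.filter (fun a => h a ∈ z.2)).card : ℤ) ≤ p z) :
    ∃ z₀ : Rect L V, h e ∈ z₀.2 ∧ ((U.filter (fun a => h a ∈ z₀.2)).card : ℤ) ≤ p z₀ ∧
      ∀ z : Rect L V, h e ∈ z.2 → ((U.filter (fun a => h a ∈ z.2)).card : ℤ) ≤ p z →
        z₀.1 ⊆ z.1 := by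
  classical
  obtain ⟨z, hz⟩ := hex
  obtain ⟨z₀, hz₀, hmin⟩ := Finset.exists_min_image
    (Finset.univ.filter (fun z : Rect L V => h e ∈ z.2 ∧
      ((U.filter (fun a => h a ∈ z.2)).card : ℤ) ≤ p z)) (fun z => z.1.card)
    ⟨z, by simpa using hz⟩
  simp only [Finset.mem_filter, Finset.mem_univ, true_and] at hz₀ hmin
  refine ⟨z₀, hz₀.1, hz₀.2, fun z hez hz => ?_⟩
  -- Arc counts are modular and the cross obeys its arc bound, so the hull is again saturated; its
  -- rows are the intersection.
  have h1 := hp z₀ z ⟨_, hz₀.1, hez⟩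
  have h2 := hU (cross z₀ z) ⟨h e, Finset.mem_inter.2 ⟨hz₀.1, hez⟩⟩
  have h3 : h e ∈ (hull z₀ z).2 := Finset.mem_union_left _ hz₀.1
  have h4 : (U.filter (fun a => h a ∈ (cross z₀ z).2)).card +
      (U.filter (fun a => h a ∈ (hull z₀ z).2)).card =
      (U.filter (fun a => h a ∈ z₀.2)).card + (U.filter (fun a => h a ∈ z.2)).card := by
    rw [← Finset.card_union_add_card_inter (U.filter (fun a => h a ∈ z₀.2)), add_comm,
      ← Finset.filter_or, ← Finset.filter_and]
    simp [cross, hull]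
  have h5 : ((U.filter (fun a => h a ∈ (hull z₀ z).2)).card : ℤ) ≤ p (hull z₀ z) := by
    have h4' : ((U.filter (fun a => h a ∈ (cross z₀ z).2)).card : ℤ) +
      ((U.filter (fun a => h a ∈ (hull z₀ z).2)).card : ℤ) =
      ((U.filter (fun a => h a ∈ z₀.2)).card : ℤ) + ((U.filter (fun a => h a ∈ z.2)).card : ℤ) := by
      exact_mod_cast h4
    linarith [hz₀.2]
  have h6 := Finset.eq_of_subset_of_card_le (Finset.inter_subset_left (s₁ := z₀.1) (s₂ := z.1))
    (hmin (hull z₀ z) ⟨h3, h5⟩)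
  exact Finset.inter_eq_left.1 h6

/-- The arcs of `U` can be distributed among the rows so that row `α` gets at most `c α` arcs and
every rectangle receives its demand. -/
theorem exists_assignment [DecidableEq A] (hp : IntersectingSupermodular p) (hc : PackingBound p c)
    (hU : ArcBound p U h) :
    ∃ f : A → Option L, (∀ α, ((U.filter (fun a => f a = some α)).card : ℤ) ≤ c α) ∧
      ∀ z : Rect L V, z.2.Nonempty →
        p z ≤ ((U.filter (fun a => h a ∈ z.2 ∧ ∃ α ∈ z.1, f a = some α)).card : ℤ) := by
  induction U using Finset.induction_on generalizing p c with
  | empty =>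
    refine ⟨fun _ => none, fun α => ?_, fun z hz => ?_⟩
    -- The empty packing shows that capacities are nonnegative.
    · have := hc ∅ {α} ⟨by simp, by simp⟩ (by simp)
      simpa using this
    · simpa using hU z hz
  | insert e U he ih =>
    have hins : ∀ (P : A → Prop) [DecidablePred P],
        (((insert e U).filter P).card : ℤ) = (if P e then 1 else 0) + ((U.filter P).card : ℤ) := by
      intro P _
      rw [Finset.filter_insert]
      split_ifs
      · rw [Finset.card_insert_of_notMem (by simp [he])]
        push_cast
        ring
      · ring
    have hupd : ∀ (f : A → Option L) (o : Option L) (P : A → Option L → Prop)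
        [∀ f : A → Option L, DecidablePred fun a => P a (f a)],
        U.filter (fun a => P a (Function.update f e o a)) = U.filter (fun a => P a (f a)) := by
      intro f o P _
      refine Finset.filter_congr fun a ha => ?_
      rw [Function.update_of_ne (ne_of_mem_of_not_mem ha he)]
    by_cases hex : ∃ z : Rect L V, h e ∈ z.2 ∧
        (((insert e U).filter (fun a => h a ∈ z.2)).card : ℤ) ≤ p z
    · obtain ⟨z₀, hez, htight, hleast⟩ := exists_least_tight hp hU hex
      obtain ⟨α, hα, hgood⟩ :=
        exists_unblocked hp hc hU (Finset.mem_insert_self e U) hez htight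
      -- Giving `e` to `α` uses one unit of capacity and serves one unit of demand in each rectangle
      -- containing the cell `(α, h e)`.
      obtain ⟨f, hf1, hf2⟩ := ih
        (p := fun z => p z - if α ∈ z.1 ∧ h e ∈ z.2 then 1 else 0)
        (c := Function.update c α (c α - 1)) (by
          intro z z' hzz
          have h1 := hp z z' hzz
          have h2 : ((if α ∈ (cross z z').1 ∧ h e ∈ (cross z z').2 then 1 else 0) : ℤ) +
              (if α ∈ (hull z z').1 ∧ h e ∈ (hull z z').2 then 1 else 0) ≤
              (if α ∈ z.1 ∧ h e ∈ z.2 then 1 else 0) +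
              (if α ∈ z'.1 ∧ h e ∈ z'.2 then 1 else 0) := by
            simp only [cross, hull, Finset.mem_union, Finset.mem_inter]
            by_cases c1 : α ∈ z.1 <;> by_cases c2 : α ∈ z'.1 <;>
              by_cases c3 : h e ∈ z.2 <;> by_cases c4 : h e ∈ z'.2 <;> simp [c1, c2, c3, c4]
          simp only
          linarith) (by
          intro 𝒻 T h𝒻 hT
          have h1 := hc 𝒻 T h𝒻 hT
          rw [Finset.sum_sub_distrib]
          by_cases hαT : α ∈ T
          · rw [Finset.sum_update_of_mem hαT, Finset.sdiff_singleton_eq_erase]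
            have h2 := Finset.add_sum_erase T c hαT
            have h3 : (0 : ℤ) ≤ ∑ z ∈ 𝒻, (if α ∈ z.1 ∧ h e ∈ z.2 then 1 else 0) :=
              Finset.sum_nonneg fun z _ => by split_ifs <;> norm_num
            by_cases htT : ∑ a ∈ T, c a ≤ ∑ z ∈ 𝒻, p z
            -- A tight packing loses demand with the capacity, by the choice of `α`; a packing that
            -- is not tight has a unit to spare by integrality.
            · obtain ⟨z, hz, hz'⟩ := hgood T 𝒻 ⟨h𝒻, hT, htT⟩ hαT
              have h4 : ((if α ∈ z.1 ∧ h e ∈ z.2 then 1 else 0) : ℤ) ≤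
                  ∑ z ∈ 𝒻, (if α ∈ z.1 ∧ h e ∈ z.2 then 1 else 0) :=
                Finset.single_le_sum (f := fun z : Rect L V =>
                  ((if α ∈ z.1 ∧ h e ∈ z.2 then 1 else 0) : ℤ))
                  (fun z _ => by split_ifs <;> norm_num) hz
              rw [if_pos hz'] at h4
              linarith
            · linarith
          · rw [Finset.sum_update_of_notMem hαT]
            have h3 : (0 : ℤ) ≤ ∑ z ∈ 𝒻, (if α ∈ z.1 ∧ h e ∈ z.2 then 1 else 0) :=
              Finset.sum_nonneg fun z _ => by split_ifs <;> norm_num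
            linarith) (by
          intro z hz
          have h1 := hU z hz
          have h2 := hleast z
          simp only [hins] at h1 h2
          by_cases hze : h e ∈ z.2
          · simp only [hze, and_true, if_true] at h1 h2 ⊢
            -- A saturated rectangle at `h e` contains all rows of `z₀`, so its demand drops
            -- together with its arc count.
            by_cases htz : 1 + ((U.filter (fun a => h a ∈ z.2)).card : ℤ) ≤ p z
            · rw [if_pos (h2 trivial htz hα)]
              linarith
            · split_ifs <;> linarith
          · simp only [hze, and_false, if_false] at h1 ⊢
            linarith)
      refine ⟨Function.update f e (some α), fun β => ?_, fun z hz => ?_⟩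
      · rw [hins, hupd f (some α) (fun _ o => o = some β), Function.update_self]
        have := hf1 β
        by_cases hβ : β = α
        · subst hβ
          rw [Function.update_self] at this
          simp only [if_true]
          linarith
        · rw [Function.update_of_ne hβ] at this
          rw [if_neg (by simpa using fun h => hβ h.symm)]
          linarith
      · have h1 := hf2 z hz
        rw [hins, hupd f (some α) (fun a o => h a ∈ z.2 ∧ ∃ α ∈ z.1, o = some α),
          Function.update_self]
        have h2 : (if α ∈ z.1 ∧ h e ∈ z.2 then 1 else 0 : ℤ) =
            if h e ∈ z.2 ∧ ∃ β ∈ z.1, some α = some β then 1 else 0 := by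
          refine if_congr ?_ rfl rfl
          simp [and_comm]
        linarith
    · push Not at hex
      -- No rectangle at `h e` is saturated, so `e` can be discarded.
      obtain ⟨f, hf1, hf2⟩ := ih hp hc (by
        intro z hz
        have h1 := hU z hz
        have h2 := hex z
        rw [hins] at h1 h2
        by_cases hze : h e ∈ z.2
        · have := h2 hze
          rw [if_pos hze] at this
          linarith
        · rwa [if_neg hze, zero_add] at h1)
      refine ⟨Function.update f e none, fun β => ?_, fun z hz => ?_⟩
      · rw [hins, hupd f none (fun _ o => o = some β), Function.update_self]
        simpa using hf1 β
      · rw [hins, hupd f none (fun a o => h a ∈ z.2 ∧ ∃ α ∈ z.1, o = some α),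
          Function.update_self]
        simpa using hf2 z hz

end Arcs

end Rect

/-! ### Extending branchings from root sets -/

section RootSets

variable {K V A : Type*} [Fintype K] [DecidableEq K] [Fintype V] [DecidableEq V] [DecidableEq A]

/-- The cut condition: every `Z` meeting `T` is entered by as many arcs of `B` as there are root
sets avoiding it. -/
def CutCondition (t h : A → V) (T : Finset V) (R : K → Finset V) (B : Finset A) : Prop :=
  ∀ Z : Finset V, (∃ v ∈ T, v ∈ Z) →
    (Finset.univ.filter (fun i => Disjoint (R i) Z)).card ≤
      (B.filter (fun a => t a ∉ Z ∧ h a ∈ Z)).card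

omit [DecidableEq A] [Fintype V] in
lemma card_entering_submodular (t h : A → V) (B : Finset A) (Z Z' : Finset V) :
    (B.filter (fun a => t a ∉ Z ∩ Z' ∧ h a ∈ Z ∩ Z')).card +
      (B.filter (fun a => t a ∉ Z ∪ Z' ∧ h a ∈ Z ∪ Z')).card ≤
    (B.filter (fun a => t a ∉ Z ∧ h a ∈ Z)).card +
      (B.filter (fun a => t a ∉ Z' ∧ h a ∈ Z')).card := by
  simp only [Finset.card_filter, ← Finset.sum_add_distrib, Finset.mem_inter, Finset.mem_union]
  refine Finset.sum_le_sum fun a _ => ?_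
  by_cases t a ∈ Z <;> by_cases t a ∈ Z' <;> by_cases h a ∈ Z <;> by_cases h a ∈ Z' <;> simp [*]

omit [DecidableEq K] [Fintype V] in
lemma card_disjoint_supermodular (R : K → Finset V) (Z Z' : Finset V) :
    (Finset.univ.filter (fun i => Disjoint (R i) Z)).card +
      (Finset.univ.filter (fun i => Disjoint (R i) Z')).card ≤
    (Finset.univ.filter (fun i => Disjoint (R i) (Z ∩ Z'))).card +
      (Finset.univ.filter (fun i => Disjoint (R i) (Z ∪ Z'))).card := by
  simp only [Finset.card_filter, ← Finset.sum_add_distrib]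
  refine Finset.sum_le_sum fun i _ => ?_
  have h1 : Disjoint (R i) Z → Disjoint (R i) (Z ∩ Z') :=
    fun h => h.mono_right Finset.inter_subset_left
  have h2 : Disjoint (R i) Z' → Disjoint (R i) (Z ∩ Z') :=
    fun h => h.mono_right Finset.inter_subset_right
  by_cases c1 : Disjoint (R i) Z <;> by_cases c2 : Disjoint (R i) Z' <;>
    simp_all [Finset.disjoint_union_right]

-- The index `i` contributes nothing on the left and one, through the intersection, on the right.
omit [DecidableEq K] [Fintype V] in
lemma card_disjoint_supermodular_lt (R : K → Finset V) (Z Z' : Finset V) {i : K}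
    (hi : ¬ Disjoint (R i) Z) (hi' : ¬ Disjoint (R i) Z') (hd : Disjoint (R i) (Z ∩ Z')) :
    (Finset.univ.filter (fun i => Disjoint (R i) Z)).card +
      (Finset.univ.filter (fun i => Disjoint (R i) Z')).card <
    (Finset.univ.filter (fun i => Disjoint (R i) (Z ∩ Z'))).card +
      (Finset.univ.filter (fun i => Disjoint (R i) (Z ∪ Z'))).card := by
  simp only [Finset.card_filter, ← Finset.sum_add_distrib]
  refine Finset.sum_lt_sum (fun i _ => ?_) ⟨i, Finset.mem_univ i, by simp [hi, hi', hd]⟩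
  have h1 : Disjoint (R i) Z → Disjoint (R i) (Z ∩ Z') :=
    fun h => h.mono_right Finset.inter_subset_left
  have h2 : Disjoint (R i) Z' → Disjoint (R i) (Z ∩ Z') :=
    fun h => h.mono_right Finset.inter_subset_right
  by_cases c1 : Disjoint (R i) Z <;> by_cases c2 : Disjoint (R i) Z' <;>
    simp_all [Finset.disjoint_union_right]

/-- Lovász's step: a root set that does not contain `T` can be enlarged along an arc without
violating the cut condition. -/
theorem CutCondition.exists_arc {t h : A → V} {T : Finset V} {R : K → Finset V} {B : Finset A}
    (hcut : CutCondition t h T R B) (hT : ∀ a ∈ B, h a ∈ T) {i : K} (hi : ¬ T ⊆ R i) :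
    ∃ a ∈ B, t a ∈ R i ∧ h a ∉ R i ∧
      CutCondition t h T (Function.update R i (insert (h a) (R i))) (B.erase a) := by
  obtain ⟨v, hvT, hvR⟩ := Finset.not_subset.1 hi
  -- No arc enters the whole vertex set, so no root set is empty.
  have huniv : ∀ j, ¬ Disjoint (R j) Finset.univ := by
    have h0 := hcut Finset.univ ⟨v, hvT, Finset.mem_univ v⟩
    simp only [Finset.mem_univ, not_true_eq_false, false_and, Finset.filter_false,
      Finset.card_empty, Nat.le_zero, Finset.card_eq_zero] at h0
    intro j hj
    exact Finset.notMem_empty j (h0 ▸ Finset.mem_filter.2 ⟨Finset.mem_univ j, hj⟩)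
  -- These are the tight sets that could obstruct enlarging `R i`; the whole vertex set is one.
  let Dangerous : Finset V → Prop := fun Z => ¬ Disjoint (R i) Z ∧ (∃ u ∈ T, u ∈ Z ∧ u ∉ R i) ∧
    (B.filter (fun a => t a ∉ Z ∧ h a ∈ Z)).card ≤
      (Finset.univ.filter (fun i => Disjoint (R i) Z)).card
  obtain ⟨Z, hZ, hmin⟩ : ∃ Z, Dangerous Z ∧ ∀ Z', Dangerous Z' → Z.card ≤ Z'.card := by
    classical
    obtain ⟨Z, hZ, hmin⟩ := Finset.exists_min_image (Finset.univ.filter Dangerous) Finset.card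
      ⟨Finset.univ, by
        rw [Finset.mem_filter]
        exact ⟨Finset.mem_univ _, huniv i, ⟨v, hvT, Finset.mem_univ v, hvR⟩, by simp⟩⟩
    simp only [Finset.mem_filter, Finset.mem_univ, true_and] at hZ hmin
    exact ⟨Z, hZ, hmin⟩
  obtain ⟨hZR, ⟨u, huT, huZ, huR⟩, hZtight⟩ := hZ
  have hlt : (Finset.univ.filter (fun i => Disjoint (R i) Z)).card <
      (Finset.univ.filter (fun j => Disjoint (R j) (Z \ R i))).card := by
    refine Finset.card_lt_card ⟨?_, fun hsub => ?_⟩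
    · intro j hj
      simp only [Finset.mem_filter, Finset.mem_univ, true_and] at hj ⊢
      exact hj.mono_right Finset.sdiff_subset
    · have := @hsub i (by simpa using Finset.disjoint_sdiff)
      exact hZR (Finset.mem_filter.1 this).2
  have hcutY := hcut (Z \ R i) ⟨u, huT, Finset.mem_sdiff.2 ⟨huZ, huR⟩⟩
  -- `Z \ R i` is entered by more arcs than `Z`; an arc entering only the former runs from `Z ∩ R i`
  -- to `Z \ R i`.
  obtain ⟨a, ha, haZ⟩ := Finset.exists_mem_notMem_of_card_lt_card
    (hZtight.trans_lt (hlt.trans_le hcutY))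
  simp only [Finset.mem_filter, Finset.mem_sdiff, not_and, not_not] at ha haZ
  obtain ⟨haB, htail, hhZ, hhR⟩ := ha
  have htZ : t a ∈ Z := by
    by_contra hn
    exact haZ haB hn hhZ
  have htR : t a ∈ R i := htail htZ
  refine ⟨a, haB, htR, hhR, fun Z' hZ' => ?_⟩
  have hcut' := hcut Z' hZ'
  have hsub : Finset.univ.filter (fun j =>
      Disjoint (Function.update R i (insert (h a) (R i)) j) Z') ⊆
      Finset.univ.filter (fun j => Disjoint (R j) Z') := by
    intro j hj
    simp only [Finset.mem_filter, Finset.mem_univ, true_and] at hj ⊢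
    by_cases hji : j = i
    · subst hji
      rw [Function.update_self] at hj
      exact hj.mono_left (Finset.subset_insert _ _)
    · rwa [Function.update_of_ne hji] at hj
  by_cases hent : t a ∉ Z' ∧ h a ∈ Z'
  · have hB : ((B.erase a).filter (fun a => t a ∉ Z' ∧ h a ∈ Z')).card + 1 =
        (B.filter (fun a => t a ∉ Z' ∧ h a ∈ Z')).card := by
      rw [Finset.filter_erase]
      exact Finset.card_erase_add_one (Finset.mem_filter.2 ⟨haB, hent⟩)
    by_cases hdisj : Disjoint (R i) Z'
    · have : (Finset.univ.filter (fun j =>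
          Disjoint (Function.update R i (insert (h a) (R i)) j) Z')).card <
          (Finset.univ.filter (fun j => Disjoint (R j) Z')).card := by
        refine Finset.card_lt_card ⟨hsub, fun hs => ?_⟩
        have := @hs i (by simpa using hdisj)
        rw [Finset.mem_filter, Function.update_self] at this
        exact Finset.disjoint_left.1 this.2 (Finset.mem_insert_self _ _) hent.2
      omega
    -- If `Z'` were tight, uncrossing with `Z` would either break the cut condition strictly or make
    -- `Z ∩ Z'` dangerous; minimality then gives `Z ⊆ Z'`, although the tail of `a` lies in `Z`
    -- only.
    · have hnt : (Finset.univ.filter (fun j => Disjoint (R j) Z')).card <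
          (B.filter (fun a => t a ∉ Z' ∧ h a ∈ Z')).card := by
        by_contra htight'
        have hI := hcut (Z ∩ Z') ⟨h a, hT a haB, Finset.mem_inter.2 ⟨hhZ, hent.2⟩⟩
        have hU := hcut (Z ∪ Z') ⟨h a, hT a haB, Finset.mem_union_left _ hhZ⟩
        have h1 := card_entering_submodular t h B Z Z'
        have h2 := card_disjoint_supermodular R Z Z'
        by_cases hdI : Disjoint (R i) (Z ∩ Z')
        · have h3 := card_disjoint_supermodular_lt R Z Z' hZR hdisj hdI
          omega
        · have := hmin (Z ∩ Z') ⟨hdI, ⟨h a, hT a haB, Finset.mem_inter.2 ⟨hhZ, hent.2⟩, hhR⟩,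
            by omega⟩
          have heq := Finset.eq_of_subset_of_card_le (Finset.inter_subset_left) this
          exact hent.1 (Finset.mem_inter.1 (heq ▸ htZ)).2
      have := Finset.card_le_card hsub
      omega
  · have hB : (B.erase a).filter (fun a => t a ∉ Z' ∧ h a ∈ Z') =
        B.filter (fun a => t a ∉ Z' ∧ h a ∈ Z') := by
      rw [Finset.filter_erase]
      exact Finset.erase_eq_of_notMem fun hmem => hent (Finset.mem_filter.1 hmem).2
    rw [hB]
    exact (Finset.card_le_card hsub).trans hcut'

end RootSets

/-! ### Walks, and adding an arc to an arborescence -/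

namespace MultiDigraph

variable {W A : Type*} {D : MultiDigraph W A}

lemma IsDiwalk.mono {B B' : Finset A} (hB : B ⊆ B') : ∀ {p : List A} {u v : W},
    D.IsDiwalk B u v p → D.IsDiwalk B' u v p
  | [], _, _, h => h
  | _ :: _, _, _, ⟨ha, ht, hp⟩ => ⟨hB ha, ht, IsDiwalk.mono hB hp⟩

lemma isDiwalk_append {B : Finset A} {v : W} {q : List A} : ∀ {p : List A} {u : W},
    D.IsDiwalk B u v (p ++ q) ↔ ∃ w, D.IsDiwalk B u w p ∧ D.IsDiwalk B w v q
  | [], u => by simp [IsDiwalk]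
  | a :: p, u => by
    simp only [List.cons_append, IsDiwalk, isDiwalk_append (p := p)]
    constructor
    · rintro ⟨h1, h2, w, h3, h4⟩
      exact ⟨w, ⟨h1, h2, h3⟩, h4⟩
    · rintro ⟨w, ⟨h1, h2, h3⟩, h4⟩
      exact ⟨h1, h2, w, h3, h4⟩

lemma IsDiwalk.head_mem {B : Finset A} : ∀ {p : List A} {u v : W}, D.IsDiwalk B u v p →
    ∀ a ∈ p, a ∈ B
  | [], _, _, _, _, ha => (List.not_mem_nil ha).elim
  | _ :: _, _, _, ⟨hb, _, hp⟩, a, ha => by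
    rcases List.mem_cons.1 ha with rfl | ha
    · exact hb
    · exact hp.head_mem a ha

/-- A walk that starts outside `X` and ends in `X` uses an arc entering `X`. -/
lemma IsDiwalk.exists_entering {B : Finset A} {X : Finset W} : ∀ {p : List A} {u v : W},
    D.IsDiwalk B u v p → u ∉ X → v ∈ X → ∃ a ∈ B, D.tail a ∉ X ∧ D.head a ∈ X
  | [], _, _, h, hu, hv => (hu (h ▸ hv)).elim
  | a :: p, u, v, ⟨ha, ht, hp⟩, hu, hv => by
    by_cases hX : D.head a ∈ X
    · exact ⟨a, ha, ht ▸ hu, hX⟩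
    · exact hp.exists_entering hX hv

namespace Subdigraph

section AddArc

variable [DecidableEq W] [DecidableEq A]

/-- The subdigraph obtained by adding an arc whose tail is already a vertex. -/
def addArc (F : D.Subdigraph) (a : A) (ha : D.tail a ∈ F.verts) : D.Subdigraph where
  verts := insert (D.head a) F.verts
  arcs := insert a F.arcs
  tail_mem b hb := by
    rcases Finset.mem_insert.1 hb with rfl | hb
    · exact Finset.mem_insert_of_mem ha
    · exact Finset.mem_insert_of_mem (F.tail_mem b hb)
  head_mem b hb := by
    rcases Finset.mem_insert.1 hb with rfl | hb
    · exact Finset.mem_insert_self _ _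
    · exact Finset.mem_insert_of_mem (F.head_mem b hb)

variable {F : D.Subdigraph} {a : A} {x : W}

omit [DecidableEq W] [DecidableEq A] in
lemma UnderlyingIsTree.card_arcs_lt (h : F.UnderlyingIsTree) : F.arcs.card + 1 ≤ F.verts.card := by
  have h1 := (SimpleGraph.isTree_iff_connected_and_card.1 h.2).2
  rw [(Nat.card_eq_fintype_card.trans (Fintype.card_coe _) : Nat.card F.verts = _)] at h1
  rw [← h1, ← Fintype.card_coe, ← Nat.card_eq_fintype_card]
  refine Nat.succ_le_succ (Nat.card_le_card_of_injective (fun a : F.arcs =>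
    (⟨s(⟨D.tail a, F.tail_mem a a.2⟩, ⟨D.head a, F.head_mem a a.2⟩),
      ⟨a, a.2, Or.inl ⟨rfl, rfl⟩⟩⟩ : F.underlying.edgeSet)) ?_)
  intro b c hbc
  have h2 := congrArg (Sym2.map Subtype.val) (congrArg Subtype.val hbc)
  simp only [Sym2.map_mk] at h2
  exact Subtype.ext (h.1 b b.2 c c.2 h2)

-- Each edge comes from an arc, so few arcs mean few edges, and a connected graph with so few edges
-- is a tree.
omit [DecidableEq W] [DecidableEq A] in
lemma isTree_underlying_of_card (hconn : F.underlying.Connected)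
    (hcard : F.arcs.card + 1 ≤ F.verts.card) : F.underlying.IsTree := by
  refine SimpleGraph.isTree_iff_connected_and_card.2 ⟨hconn, ?_⟩
  have h1 := hconn.card_vert_le_card_edgeSet_add_one
  have h2 : Nat.card F.underlying.edgeSet ≤ F.arcs.card := by
    rw [← Fintype.card_coe, ← Nat.card_eq_fintype_card]
    refine Nat.card_le_card_of_surjective (fun a : F.arcs =>
      (⟨s(⟨D.tail a, F.tail_mem a a.2⟩, ⟨D.head a, F.head_mem a a.2⟩),
        ⟨a, a.2, Or.inl ⟨rfl, rfl⟩⟩⟩ : F.underlying.edgeSet)) ?_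
    rintro ⟨e, he⟩
    induction e using Sym2.ind with
    | _ u v =>
      obtain ⟨a, ha, h⟩ := he
      refine ⟨⟨a, ha⟩, Subtype.ext ?_⟩
      rcases h with ⟨h1, h2⟩ | ⟨h1, h2⟩
      · simp [h1, h2]
      · simp [h1, h2, Sym2.eq_swap]
  rw [(Nat.card_eq_fintype_card.trans (Fintype.card_coe _) : Nat.card F.verts = _)] at h1 ⊢
  omega

lemma connected_addArc (hF : F.underlying.Connected) (ha : D.tail a ∈ F.verts) :
    (F.addArc a ha).underlying.Connected := by
  let φ : F.underlying →g (F.addArc a ha).underlying :=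
    { toFun := fun v => ⟨v, Finset.mem_insert_of_mem v.2⟩
      map_rel' := fun {u v} ⟨b, hb, h⟩ => ⟨b, Finset.mem_insert_of_mem hb, h⟩ }
  have hr : ∀ v : {v // v ∈ (F.addArc a ha).verts},
      (F.addArc a ha).underlying.Reachable (φ ⟨D.tail a, ha⟩) v := by
    rintro ⟨v, hv⟩
    rcases Finset.mem_insert.1 hv with rfl | hv'
    · exact SimpleGraph.Adj.reachable ⟨a, Finset.mem_insert_self _ _, Or.inl ⟨rfl, rfl⟩⟩
    · exact (hF.preconnected ⟨D.tail a, ha⟩ ⟨v, hv'⟩).map φ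
  have : Nonempty {v // v ∈ (F.addArc a ha).verts} := ⟨φ ⟨D.tail a, ha⟩⟩
  exact ⟨fun u v => (hr u).symm.trans (hr v)⟩

/-- A walk that does not end at the new vertex avoids the new arc. -/
lemma isDiwalk_of_addArc (ha : D.tail a ∈ F.verts) (hh : D.head a ∉ F.verts) :
    ∀ {p : List A} {u v : W}, D.IsDiwalk (F.addArc a ha).arcs u v p → v ∈ F.verts →
      D.IsDiwalk F.arcs u v p
  | [], _, _, h, _ => h
  | b :: p, u, v, ⟨hb, ht, hp⟩, hv => by
    rcases Finset.mem_insert.1 hb with rfl | hb'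
    -- The new arc would be last, ending at the new vertex, or be followed by an arc leaving that
    -- vertex, and there is none.
    · cases p with
      | nil => exact (hh ((show D.head b = v from hp).symm ▸ hv)).elim
      | cons c p =>
        have hc : D.tail c ∈ F.verts := by
          rcases Finset.mem_insert.1 hp.1 with rfl | hc
          · exact ha
          · exact F.tail_mem c hc
        exact (hh (hp.2.1 ▸ hc)).elim
    · exact ⟨hb', ht, isDiwalk_of_addArc ha hh hp hv⟩

/-- Adding an arc from a vertex to a new vertex preserves arborescences. -/
theorem IsArborescence.addArc (hF : F.IsArborescence x) (ha : D.tail a ∈ F.verts)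
    (hh : D.head a ∉ F.verts) : (F.addArc a ha).IsArborescence x := by
  obtain ⟨hx, htree, hpath⟩ := hF
  have haF : a ∉ F.arcs := fun h => hh (F.head_mem a h)
  refine ⟨Finset.mem_insert_of_mem hx, ⟨?_, ?_⟩, ?_⟩
  · have hnew : ∀ b ∈ F.arcs, s(D.tail a, D.head a) ≠ s(D.tail b, D.head b) := by
      intro b hb h
      rw [Sym2.eq_iff] at h
      rcases h with h | h
      · exact hh (h.2 ▸ F.head_mem b hb)
      · exact hh (h.2 ▸ F.tail_mem b hb)
    intro b hb c hc hbc
    rcases Finset.mem_insert.1 hb with rfl | hb' <;> rcases Finset.mem_insert.1 hc with rfl | hc'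
    · rfl
    · exact (hnew c hc' hbc).elim
    · exact (hnew b hb' hbc.symm).elim
    · exact htree.1 b hb' c hc' hbc
  · refine isTree_underlying_of_card (connected_addArc htree.2.connected ha) ?_
    have := htree.card_arcs_lt
    rw [Subdigraph.addArc, Finset.card_insert_of_notMem haF, Finset.card_insert_of_notMem hh]
    omega
  · intro u hu
    rcases Finset.mem_insert.1 hu with rfl | hu'
    · obtain ⟨p, hp, hpu⟩ := hpath _ ha
      refine ⟨p ++ [a], ⟨?_, ?_⟩, ?_⟩
      · exact isDiwalk_append.2 ⟨_, hp.1.mono (Finset.subset_insert _ _),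
          Finset.mem_insert_self _ _, rfl, rfl⟩
      · rw [List.map_append, ← List.cons_append]
        refine List.nodup_append.2 ⟨hp.2, by simp, ?_⟩
        intro v hv w hw hvw
        simp only [List.map_cons, List.map_nil, List.mem_singleton] at hw
        subst hvw
        rw [hw, List.mem_cons, List.mem_map] at hv
        rcases hv with hv | ⟨b, hb, hb'⟩
        · exact hh (hv ▸ hx)
        · exact hh (hb' ▸ F.head_mem b (hp.1.head_mem b hb))
      · rintro q ⟨hq, hqn⟩
        rcases List.eq_nil_or_concat q with rfl | ⟨q', b, rfl⟩
        · exact (hh ((show x = D.head a from hq) ▸ hx)).elim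
        · rw [List.concat_eq_append] at hq hqn ⊢
          obtain ⟨w, hq', hb, hbt, hbh⟩ := isDiwalk_append.1 hq
          have hba : b = a := by
            rcases Finset.mem_insert.1 hb with h | h
            · exact h
            · exact (hh ((show D.head b = D.head a from hbh) ▸ F.head_mem b h)).elim
          subst hba hbt
          rw [hpu q' ⟨isDiwalk_of_addArc ha hh hq' ha, ?_⟩]
          rw [List.map_append, ← List.cons_append] at hqn
          exact (List.nodup_append.1 hqn).1
    · obtain ⟨p, hp, hpu⟩ := hpath u hu'
      exact ⟨p, ⟨hp.1.mono (Finset.subset_insert _ _), hp.2⟩,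
        fun q hq => hpu q ⟨isDiwalk_of_addArc ha hh hq.1 hu', hq.2⟩⟩

end AddArc

end Subdigraph

end MultiDigraph

/-! ### Extension with the root split into blocks -/

namespace MultiDigraph

variable {W A : Type*} {D : MultiDigraph W A}

/-- The tail of an arc after the vertex `x` has been split into one vertex for each block, `e`
telling the blocks of the arcs that leave `x`. -/
def splitTail [DecidableEq W] (D : MultiDigraph W A) (x : W) {L : Type*} (e : A → Option L)
    (a : A) : W ⊕ L :=
  if D.tail a = x then (e a).elim (Sum.inl x) Sum.inr else Sum.inl (D.tail a)

namespace Subdigraph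

/-- Arborescences can be extended to spanning ones under the cut condition in the digraph where
the root is split. -/
theorem exists_spanning_of_cutCondition [Fintype W] [DecidableEq W] [DecidableEq A] {x : W}
    {k : ℕ} {L : Type*} [Fintype L] [DecidableEq L] (blk : Fin k → L) (e : A → Option L)
    (B : Finset A) (F : Fin k → D.Subdigraph)
    (hF : ∀ i, (F i).IsArborescence x) (hdisj : ArcDisjoint F)
    (hB : ∀ a ∈ B, ∀ i, a ∉ (F i).arcs) (hBe : ∀ a ∈ B, D.tail a = x → e a ≠ none)
    (hcut : CutCondition (D.splitTail x e) (fun a => Sum.inl (D.head a))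
      (Finset.univ.disjSum ∅) (fun i => (F i).verts.disjSum {blk i}) B) :
    ∃ F' : Fin k → D.Subdigraph,
      (∀ i, (F' i).IsArborescence x ∧ (F' i).IsSpanning ∧ (F i).IsSubdigraphOf (F' i)) ∧
      ArcDisjoint F' ∧
      ∀ i, ∀ a ∈ (F' i).arcs, a ∉ (F i).arcs → a ∈ B ∧ (D.tail a = x → e a = some (blk i)) := by
  obtain ⟨n, hn⟩ : ∃ n, B.card = n := ⟨_, rfl⟩
  induction n using Nat.strong_induction_on generalizing B F with
  | _ n ih =>
    by_cases hsp : ∀ i, (F i).IsSpanning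
    · exact ⟨F, fun i => ⟨hF i, hsp i, subset_rfl, subset_rfl⟩, hdisj,
        fun i a ha ha' => (ha' ha).elim⟩
    push Not at hsp
    obtain ⟨i, hi⟩ := hsp
    obtain ⟨a, haB, hta, hha, hcut'⟩ := hcut.exists_arc (i := i)
      (by intro a _; simp) (by
        intro hsub
        refine hi fun v => ?_
        have := hsub (show Sum.inl v ∈ (Finset.univ : Finset W).disjSum ∅ by simp)
        simpa using this)
    rw [Finset.inl_mem_disjSum] at hha
    -- The only split root in the `i`-th root set is that of block `blk i`, so a chosen root arc was
    -- given to this block.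
    have ht : D.tail a ∈ (F i).verts ∧ (D.tail a = x → e a = some (blk i)) := by
      unfold splitTail at hta
      split_ifs at hta with hx
      · refine ⟨hx ▸ (hF i).1, fun _ => ?_⟩
        cases hea : e a with
        | none => exact (hBe a haB hx hea).elim
        | some α =>
          rw [hea] at hta
          simpa using hta
      · exact ⟨by simpa using hta, fun h => (hx h).elim⟩
    set F₁ := Function.update F i ((F i).addArc a ht.1) with hF₁
    have hF₁i : F₁ i = (F i).addArc a ht.1 := by rw [hF₁, Function.update_self]
    have hF₁j : ∀ j, j ≠ i → F₁ j = F j := fun j hj => by rw [hF₁, Function.update_of_ne hj]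
    have harcs : ∀ j b, b ∈ (F₁ j).arcs ↔ (b = a ∧ j = i) ∨ b ∈ (F j).arcs := by
      intro j b
      by_cases hj : j = i
      · subst hj
        rw [hF₁i]
        simp [addArc]
      · simp [hF₁j j hj, hj]
    have hsub : ∀ j, (F j).IsSubdigraphOf (F₁ j) := by
      intro j
      refine ⟨?_, fun b hb => (harcs j b).2 (Or.inr hb)⟩
      by_cases hj : j = i
      · subst hj
        rw [hF₁i]
        exact Finset.subset_insert _ _
      · rw [hF₁j j hj]
    obtain ⟨F', h1, h2, h3⟩ := ih (B.erase a).card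
      (by rw [← hn]; exact Finset.card_erase_lt_of_mem haB) (B.erase a) F₁ (by
        intro j
        by_cases hj : j = i
        · subst hj
          rw [hF₁i]
          exact (hF j).addArc ht.1 hha
        · rw [hF₁j j hj]
          exact hF j) (by
        intro j j' hjj
        rw [Finset.disjoint_left]
        intro b hb hb'
        rw [harcs] at hb hb'
        rcases hb with ⟨rfl, rfl⟩ | hb <;> rcases hb' with ⟨hba, rfl⟩ | hb'
        · exact hjj rfl
        · exact hB b haB _ hb'
        · exact hB b (hba ▸ haB) _ hb
        · exact Finset.disjoint_left.1 (hdisj hjj) hb hb') (by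
        intro b hb j hbj
        rw [Finset.mem_erase] at hb
        rcases (harcs j b).1 hbj with h | h
        · exact hb.1 h.1
        · exact hB b hb.2 j h) (fun b hb => hBe b (Finset.mem_of_mem_erase hb)) (by
        convert hcut' using 1
        funext j
        by_cases hj : j = i
        · subst hj
          rw [hF₁i, Function.update_self]
          ext v
          cases v <;> simp [addArc]
        · rw [hF₁j j hj, Function.update_of_ne hj]) rfl
    refine ⟨F', fun j => ⟨(h1 j).1, (h1 j).2.1, (hsub j).1.trans (h1 j).2.2.1,
      (hsub j).2.trans (h1 j).2.2.2⟩, h2, fun j b hb hbF => ?_⟩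
    by_cases hb₁ : b ∈ (F₁ j).arcs
    · rcases (harcs j b).1 hb₁ with ⟨rfl, rfl⟩ | h
      · exact ⟨haB, ht.2⟩
      · exact (hbF h).elim
    · obtain ⟨h4, h5⟩ := h3 j b hb hb₁
      exact ⟨Finset.mem_of_mem_erase h4, h5⟩

/-! ### Necessity of the two conditions -/

section Extension

variable [Fintype W] [DecidableEq W] [Fintype A] [DecidableEq A] {x : W} {k l : ℕ}
  {I : Fin l → Finset (Fin k)} {F F' : Fin k → D.Subdigraph}

omit [Fintype W] [DecidableEq W] in
lemma mem_freeArcs {a : A} : a ∈ freeArcs F ↔ ∀ i, a ∉ (F i).arcs := by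
  simp [freeArcs]

omit [Fintype W] in
lemma mem_freeArcsAvoiding {a : A} :
    a ∈ freeArcsAvoiding F x ↔ (∀ i, a ∉ (F i).arcs) ∧ D.tail a ≠ x := by
  simp [freeArcsAvoiding, outArcs]

lemma filter_subset_biUnion (hI : IsIndexPartition I) (S : Finset (Fin l)) :
    Finset.univ.filter (fun α => I α ⊆ S.biUnion I) = S := by
  ext α
  simp only [Finset.mem_filter, Finset.mem_univ, true_and]
  refine ⟨fun h => ?_, fun h => Finset.subset_biUnion_of_mem I h⟩
  obtain ⟨i, hi⟩ := hI.1 α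
  obtain ⟨β, hβ, hiβ⟩ := Finset.mem_biUnion.1 (h hi)
  by_cases hαβ : α = β
  · rwa [hαβ]
  · exact (Finset.disjoint_left.1 (hI.2.1 hαβ) hi hiβ).elim

-- The path from `x` in `F' i` must enter `X`. The entering arc is not in `F i`, which misses `X`,
-- nor in another `F j`, by disjointness of the extensions.
omit [Fintype W] [DecidableEq W] in
lemma exists_free_entering
    (hF' : ∀ i, (F' i).IsArborescence x ∧ (F' i).IsSpanning ∧ (F i).IsSubdigraphOf (F' i))
    (hdisj' : ArcDisjoint F') {X : Finset W} (hx : x ∉ X) (hX : X.Nonempty) {i : Fin k}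
    (hi : Disjoint X (F i).verts) :
    ∃ a ∈ (F' i).arcs, a ∈ freeArcs F ∧ D.tail a ∉ X ∧ D.head a ∈ X := by
  obtain ⟨v, hv⟩ := hX
  obtain ⟨p, hp, -⟩ := (hF' i).1.2.2 v ((hF' i).2.1 v)
  obtain ⟨a, ha, hta, hha⟩ := hp.1.exists_entering hx hv
  refine ⟨a, ha, mem_freeArcs.2 fun j hj => ?_, hta, hha⟩
  by_cases hji : j = i
  · subst hji
    exact Finset.disjoint_left.1 hi hha ((F j).head_mem a hj)
  · exact Finset.disjoint_left.1 (hdisj' hji) ((hF' j).2.2.2 hj) ha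

omit [Fintype W] [Fintype A] [DecidableEq A] in
/-- If each missing index has its own arc in `Y` then there are at most `|Y|` missing indices. -/
lemma card_missing_le (hdisj' : ArcDisjoint F') {J : Finset (Fin k)} {X : Finset W}
    {Y : Finset A} (h : ∀ i ∈ missing F J X, ∃ a ∈ (F' i).arcs, a ∈ Y) :
    (missing F J X).card ≤ Y.card := by
  rcases (missing F J X).eq_empty_or_nonempty with h0 | ⟨i₀, hi₀⟩
  · simp [h0]
  have : Nonempty A := ⟨(h i₀ hi₀).choose⟩
  choose! f hf hfY using h
  refine Finset.card_le_card_of_injOn f hfY fun i hi j hj hij => ?_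
  by_contra hne
  exact Finset.disjoint_left.1 (hdisj' hne) (hf i hi) (hij ▸ hf j hj)

omit [Fintype W] in
theorem missing_le_of_extension
    (hF' : ∀ i, (F' i).IsArborescence x ∧ (F' i).IsSpanning ∧ (F i).IsSubdigraphOf (F' i))
    (hdisj' : ArcDisjoint F') {X : Finset W} (hx : x ∉ X) (hX : X.Nonempty) :
    (missing F Finset.univ X).card ≤ D.inDegree (freeArcs F) X := by
  refine card_missing_le hdisj' fun i hi => ?_
  obtain ⟨a, ha, haf, hent⟩ :=
    exists_free_entering hF' hdisj' hx hX (Finset.mem_filter.1 hi).2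
  exact ⟨a, ha, Finset.mem_filter.2 ⟨haf, hent⟩⟩

omit [Fintype W] in
theorem sum_missing_le_of_extension (hI : IsIndexPartition I) {c' : Fin l → ℕ}
    (hF' : ∀ i, (F' i).IsArborescence x ∧ (F' i).IsSpanning ∧ (F i).IsSubdigraphOf (F' i))
    (hdisj' : ArcDisjoint F') (hdeg' : ∀ α, ∑ i ∈ I α, D.outDegree (F' i).arcs x ≤ c' α)
    {t : ℕ} {X : Fin t → Finset W} (hx : ∀ j, x ∉ X j) (hX : ∀ j, (X j).Nonempty)
    (hXd : Pairwise fun i j => Disjoint (X i) (X j)) (S : Finset (Fin l)) :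
    ∑ j, (((missing F (S.biUnion I) (X j)).card : ℤ) -
        (D.inDegree (freeArcsAvoiding F x) (X j) : ℤ)) ≤
      ∑ α ∈ S, ((c' α : ℤ) - ∑ i ∈ I α, (D.outDegree (F i).arcs x : ℤ)) := by
  -- The root arcs gained by the chosen blocks; their number is at most the remaining capacity.
  set Y := (S.biUnion I).biUnion fun i => D.outArcs (F' i).arcs x \ D.outArcs (F i).arcs x
    with hY
  have hj : ∀ j, (missing F (S.biUnion I) (X j)).card ≤
      D.inDegree (freeArcsAvoiding F x) (X j) + (Y.filter (fun a => D.head a ∈ X j)).card := by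
    intro j
    refine (card_missing_le hdisj' (Y := (freeArcsAvoiding F x).filter
      (fun a => D.tail a ∉ X j ∧ D.head a ∈ X j) ∪ Y.filter (fun a => D.head a ∈ X j))
      fun i hi => ?_).trans (Finset.card_union_le _ _)
    obtain ⟨hiJ, hid⟩ := Finset.mem_filter.1 hi
    obtain ⟨a, ha, haf, hent⟩ := exists_free_entering hF' hdisj' (hx j) (hX j) hid
    refine ⟨a, ha, Finset.mem_union.2 ?_⟩
    rw [mem_freeArcs] at haf
    by_cases hax : D.tail a = x
    · refine Or.inr (Finset.mem_filter.2 ⟨Finset.mem_biUnion.2 ⟨i, hiJ, ?_⟩, hent.2⟩)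
      simp [outArcs, ha, hax, haf i]
    · exact Or.inl (Finset.mem_filter.2 ⟨mem_freeArcsAvoiding.2 ⟨haf, hax⟩, hent⟩)
  have hYX : ∑ j, (Y.filter (fun a => D.head a ∈ X j)).card ≤ Y.card := by
    rw [← Finset.card_biUnion]
    · refine Finset.card_le_card fun a ha => ?_
      simp only [Finset.mem_biUnion, Finset.mem_filter] at ha
      obtain ⟨_, _, h, _⟩ := ha
      exact h
    · intro i _ j _ hij
      refine Finset.disjoint_left.2 fun a ha ha' => ?_
      exact Finset.disjoint_left.1 (hXd hij) (Finset.mem_filter.1 ha).2 (Finset.mem_filter.1 ha').2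
  have hYcard : (Y.card : ℤ) ≤ ∑ i ∈ S.biUnion I,
      ((D.outDegree (F' i).arcs x : ℤ) - D.outDegree (F i).arcs x) := by
    have h1 : Y.card ≤ _ := Finset.card_biUnion_le
    refine (Nat.cast_le.2 h1).trans ?_
    push_cast
    refine Finset.sum_le_sum fun i _ => ?_
    have hsub : D.outArcs (F i).arcs x ⊆ D.outArcs (F' i).arcs x :=
      Finset.filter_subset_filter _ (hF' i).2.2.2
    have := Finset.card_sdiff_add_card_eq_card hsub
    simp only [outDegree]
    omega
  have hsplit := Finset.sum_biUnion (s := S) (t := I)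
    (f := fun i => ((D.outDegree (F' i).arcs x : ℤ) - D.outDegree (F i).arcs x))
    (fun α _ β _ hαβ => hI.2.1 hαβ)
  calc _ ≤ ∑ j, ((Y.filter (fun a => D.head a ∈ X j)).card : ℤ) :=
        Finset.sum_le_sum fun j _ => by
          have := hj j
          omega
    _ ≤ (Y.card : ℤ) := by exact_mod_cast hYX
    _ ≤ _ := hYcard
    _ = _ := hsplit
    _ ≤ _ := Finset.sum_le_sum fun α _ => by
        rw [Finset.sum_sub_distrib]
        have := hdeg' α
        have : (∑ i ∈ I α, (D.outDegree (F' i).arcs x : ℤ)) ≤ c' α := by exact_mod_cast this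
        linarith

/-- The demand of a rectangle: the number of arborescences with index in the rows that have no
vertex in the second side, minus the number of free arcs entering it that do not leave `x`. -/
def demand (F : Fin k → D.Subdigraph) (x : W) (blk : Fin k → Fin l)
    (z : Rect (Fin l) W) : ℤ :=
  ((Finset.univ.filter (fun i => blk i ∈ z.1 ∧ Disjoint z.2 (F i).verts)).card : ℤ) -
    (D.inDegree (freeArcsAvoiding F x) z.2 : ℤ)

/-! ### Sufficiency: demands and the resulting cut condition -/

variable {blk : Fin k → Fin l}

omit [Fintype W] in
lemma demand_mono {z z' : Rect (Fin l) W} (h1 : z.1 ⊆ z'.1) (h2 : z.2 = z'.2) :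
    demand F x blk z ≤ demand F x blk z' := by
  have : (Finset.univ.filter (fun i => blk i ∈ z.1 ∧ Disjoint z.2 (F i).verts)).card ≤
      (Finset.univ.filter (fun i => blk i ∈ z'.1 ∧ Disjoint z'.2 (F i).verts)).card := by
    refine Finset.card_le_card fun i hi => ?_
    simp only [Finset.mem_filter, Finset.mem_univ, true_and] at hi ⊢
    exact ⟨h1 hi.1, h2 ▸ hi.2⟩
  unfold demand
  rw [h2] at this ⊢
  omega

omit [Fintype W] in
lemma demand_nonpos (hF : ∀ i, (F i).IsArborescence x) {z : Rect (Fin l) W} (hx : x ∈ z.2) :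
    demand F x blk z ≤ 0 := by
  have : Finset.univ.filter (fun i => blk i ∈ z.1 ∧ Disjoint z.2 (F i).verts) = ∅ := by
    refine Finset.filter_eq_empty_iff.2 fun i _ h => ?_
    exact Finset.disjoint_left.1 h.2 hx (hF i).1
  simp [demand, this]

omit [Fintype W] in
lemma demand_eq_missing (hblk : ∀ i α, i ∈ I α ↔ blk i = α) (z : Rect (Fin l) W) :
    demand F x blk z = ((missing F (z.1.biUnion I) z.2).card : ℤ) -
      (D.inDegree (freeArcsAvoiding F x) z.2 : ℤ) := by
  have : missing F (z.1.biUnion I) z.2 =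
      Finset.univ.filter (fun i => blk i ∈ z.1 ∧ Disjoint z.2 (F i).verts) := by
    ext i
    simp [missing, hblk]
  rw [demand, this]

omit [Fintype W] in
lemma demand_supermodular : Rect.IntersectingSupermodular (demand F x blk) := by
  intro z z' _
  have h1 : D.inDegree (freeArcsAvoiding F x) (z.2 ∩ z'.2) +
      D.inDegree (freeArcsAvoiding F x) (z.2 ∪ z'.2) ≤
      D.inDegree (freeArcsAvoiding F x) z.2 + D.inDegree (freeArcsAvoiding F x) z'.2 :=
    card_entering_submodular D.tail D.head (freeArcsAvoiding F x) z.2 z'.2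
  have h2 : (Finset.univ.filter (fun i => blk i ∈ z.1 ∧ Disjoint z.2 (F i).verts)).card +
      (Finset.univ.filter (fun i => blk i ∈ z'.1 ∧ Disjoint z'.2 (F i).verts)).card ≤
      (Finset.univ.filter (fun i => blk i ∈ (Rect.cross z z').1 ∧
        Disjoint (Rect.cross z z').2 (F i).verts)).card +
      (Finset.univ.filter (fun i => blk i ∈ (Rect.hull z z').1 ∧
        Disjoint (Rect.hull z z').2 (F i).verts)).card := by
    simp only [Finset.card_filter, ← Finset.sum_add_distrib, Rect.cross, Rect.hull,
      Finset.mem_union, Finset.mem_inter, Finset.disjoint_union_left]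
    refine Finset.sum_le_sum fun i _ => ?_
    have h3 : Disjoint z.2 (F i).verts → Disjoint (z.2 ∩ z'.2) (F i).verts :=
      fun h => h.mono_left Finset.inter_subset_left
    have h4 : Disjoint z'.2 (F i).verts → Disjoint (z.2 ∩ z'.2) (F i).verts :=
      fun h => h.mono_left Finset.inter_subset_right
    by_cases c1 : Disjoint z.2 (F i).verts <;> by_cases c2 : Disjoint z'.2 (F i).verts <;>
      by_cases c3 : blk i ∈ z.1 <;> by_cases c4 : blk i ∈ z'.1 <;> simp [c1, c2, c3, c4, h3, h4]
  simp only [Rect.cross, Rect.hull, demand] at h2 ⊢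
  omega

-- Members containing `x` have nonpositive demand and can be dropped; widening the rows of the
-- others to all of `T` only raises demand, which reduces to condition (ii).
omit [Fintype W] in
lemma demand_packingBound (hI : IsIndexPartition I) (hblk : ∀ i α, i ∈ I α ↔ blk i = α)
    (hF : ∀ i, (F i).IsArborescence x) {c : Fin l → ℤ}
    (hc : ∀ (t : ℕ) (X : Fin t → Finset W),
      (∀ j, x ∉ X j) → (∀ j, (X j).Nonempty) → (Pairwise fun i j => Disjoint (X i) (X j)) →
      ∀ J : Finset (Fin k), (∃ S : Finset (Fin l), J = S.biUnion I) →
        ∑ j, (((missing F J (X j)).card : ℤ) -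
            (D.inDegree (freeArcsAvoiding F x) (X j) : ℤ)) ≤
          ∑ α ∈ Finset.univ.filter (fun α => I α ⊆ J), c α) :
    Rect.PackingBound (demand F x blk) c := by
  intro 𝒻 T h𝒻 hT
  set 𝒢 := 𝒻.filter (fun z => x ∉ z.2) with h𝒢
  have hmem : ∀ j, ((𝒢.equivFin.symm j : 𝒢) : Rect (Fin l) W) ∈ 𝒻 ∧
      x ∉ ((𝒢.equivFin.symm j : 𝒢) : Rect (Fin l) W).2 := fun j =>
    Finset.mem_filter.1 (𝒢.equivFin.symm j).2
  have key := hc 𝒢.card (fun j => ((𝒢.equivFin.symm j : 𝒢) : Rect (Fin l) W).2)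
    (fun j => (hmem j).2) (fun j => h𝒻.1 _ (hmem j).1) (fun i j hij => by
      refine Finset.disjoint_left.2 fun w hw hw' => hij ?_
      exact 𝒢.equivFin.symm.injective
        (Subtype.ext (h𝒻.2 _ (hmem i).1 _ (hmem j).1 w hw hw'))) (T.biUnion I) ⟨T, rfl⟩
  rw [filter_subset_biUnion hI] at key
  rw [Equiv.sum_comp 𝒢.equivFin.symm (fun z : 𝒢 =>
    ((missing F (T.biUnion I) (z : Rect (Fin l) W).2).card : ℤ) -
      (D.inDegree (freeArcsAvoiding F x) (z : Rect (Fin l) W).2 : ℤ)),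
    Finset.sum_coe_sort 𝒢 (fun z => ((missing F (T.biUnion I) z.2).card : ℤ) -
      (D.inDegree (freeArcsAvoiding F x) z.2 : ℤ))] at key
  refine le_trans ?_ key
  rw [← Finset.sum_filter_add_sum_filter_not 𝒻 (fun z => x ∉ z.2)]
  have h1 : ∑ z ∈ 𝒻.filter (fun z => ¬ x ∉ z.2), demand F x blk z ≤ 0 :=
    Finset.sum_nonpos fun z hz => demand_nonpos hF (not_not.1 (Finset.mem_filter.1 hz).2)
  have h2 : ∑ z ∈ 𝒢, demand F x blk z ≤ ∑ z ∈ 𝒢, (((missing F (T.biUnion I) z.2).card : ℤ) -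
      (D.inDegree (freeArcsAvoiding F x) z.2 : ℤ)) := by
    refine Finset.sum_le_sum fun z hz => ?_
    rw [← demand_eq_missing hblk (T, z.2)]
    exact demand_mono (hT z (Finset.mem_filter.1 hz).1) rfl
  linarith

omit [Fintype W] in
lemma demand_arcBound (hF : ∀ i, (F i).IsArborescence x)
    (hd : ∀ X : Finset W, x ∉ X → X.Nonempty →
      (missing F Finset.univ X).card ≤ D.inDegree (freeArcs F) X) :
    Rect.ArcBound (demand F x blk) (D.outArcs (freeArcs F) x) D.head := by
  intro z hz
  by_cases hx : x ∈ z.2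
  · exact (demand_nonpos hF hx).trans (Int.natCast_nonneg _)
  have h1 := hd z.2 hx hz
  have h2 : (Finset.univ.filter (fun i => blk i ∈ z.1 ∧ Disjoint z.2 (F i).verts)).card ≤
      (missing F Finset.univ z.2).card :=
    Finset.card_le_card fun i hi =>
      Finset.mem_filter.2 ⟨Finset.mem_univ i, (Finset.mem_filter.1 hi).2.2⟩
  have h3 : D.inDegree (freeArcs F) z.2 ≤ D.inDegree (freeArcsAvoiding F x) z.2 +
      ((D.outArcs (freeArcs F) x).filter (fun a => D.head a ∈ z.2)).card := by
    refine (Finset.card_le_card fun a ha => ?_).trans (Finset.card_union_le _ _)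
    rw [Finset.mem_filter, mem_freeArcs] at ha
    by_cases hax : D.tail a = x
    · exact Finset.mem_union_right _ (Finset.mem_filter.2
        ⟨Finset.mem_filter.2 ⟨mem_freeArcs.2 ha.1, hax⟩, ha.2.2⟩)
    · exact Finset.mem_union_left _ (Finset.mem_filter.2
        ⟨mem_freeArcsAvoiding.2 ⟨ha.1, hax⟩, ha.2⟩)
  simp only [demand]
  omega

/-- An assignment of the free arcs leaving `x` to blocks that meets all demands yields the cut
condition after splitting `x`. -/
lemma cutCondition_of_assignment {e : A → Option (Fin l)}
    (he : ∀ z : Rect (Fin l) W, z.2.Nonempty → demand F x blk z ≤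
      (((D.outArcs (freeArcs F) x).filter
        (fun a => D.head a ∈ z.2 ∧ ∃ α ∈ z.1, e a = some α)).card : ℤ)) :
    CutCondition (D.splitTail x e) (fun a => Sum.inl (D.head a)) (Finset.univ.disjSum ∅)
      (fun i => (F i).verts.disjSum {blk i})
      (freeArcsAvoiding F x ∪ (D.outArcs (freeArcs F) x).filter (fun a => e a ≠ none)) := by
  rintro Z ⟨u, hu, huZ⟩
  obtain ⟨v, rfl⟩ : ∃ v, u = Sum.inl v := by
    cases u with
    | inl v => exact ⟨v, rfl⟩
    | inr α => simp at hu
  -- A root set avoids `Z` exactly when its block's root lies outside `Z` and its arborescence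
  -- misses the vertices of `Z`. Hence rows are the complement of `Z` among the roots.
  set X : Finset W := Finset.univ.filter (fun v => Sum.inl v ∈ Z) with hX
  set S : Finset (Fin l) := Finset.univ.filter (fun α => Sum.inr α ∉ Z) with hS
  have h1 := he (S, X) ⟨v, by simpa [hX] using huZ⟩
  have h2 : Finset.univ.filter (fun i => Disjoint ((F i).verts.disjSum {blk i}) Z) =
      Finset.univ.filter (fun i => blk i ∈ S ∧ Disjoint X (F i).verts) := by
    ext i
    simp only [Finset.mem_filter, Finset.mem_univ, true_and, hS, hX, Finset.disjoint_left]
    constructor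
    · intro h
      exact ⟨h (by simp), fun w hw hw' => h (Finset.inl_mem_disjSum.2 hw') hw⟩
    · rintro ⟨h3, h4⟩ (w | α) hw
      · exact fun hwZ => h4 hwZ (Finset.inl_mem_disjSum.1 hw)
      · rw [Finset.inr_mem_disjSum, Finset.mem_singleton] at hw
        rwa [hw]
  have h3 : D.inDegree (freeArcsAvoiding F x) X + ((D.outArcs (freeArcs F) x).filter
      (fun a => D.head a ∈ X ∧ ∃ α ∈ S, e a = some α)).card ≤
      ((freeArcsAvoiding F x ∪ (D.outArcs (freeArcs F) x).filter (fun a => e a ≠ none)).filter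
        (fun a => D.splitTail x e a ∉ Z ∧ Sum.inl (D.head a) ∈ Z)).card := by
    rw [inDegree, ← Finset.card_union_of_disjoint]
    · refine Finset.card_le_card fun a ha => ?_
      rcases Finset.mem_union.1 ha with ha | ha
      · obtain ⟨ha, hta, hha⟩ := Finset.mem_filter.1 ha
        refine Finset.mem_filter.2 ⟨Finset.mem_union_left _ ha, ?_, by simpa [hX] using hha⟩
        rw [splitTail, if_neg (mem_freeArcsAvoiding.1 ha).2]
        simpa [hX] using hta
      · obtain ⟨ha, hha, α, hα, hea⟩ := Finset.mem_filter.1 ha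
        refine Finset.mem_filter.2 ⟨Finset.mem_union_right _ (Finset.mem_filter.2 ⟨ha, ?_⟩), ?_,
          by simpa [hX] using hha⟩
        · simp [hea]
        · rw [splitTail, if_pos (Finset.mem_filter.1 ha).2, hea]
          simpa [hS] using hα
    · refine Finset.disjoint_left.2 fun a ha ha' => ?_
      exact (mem_freeArcsAvoiding.1 (Finset.mem_filter.1 ha).1).2
        (Finset.mem_filter.1 (Finset.mem_filter.1 ha').1).2
  rw [h2]
  simp only [demand] at h1
  refine le_trans ?_ h3
  omega

omit [Fintype W] [Fintype A] in
lemma sum_outDegree_le {K : Finset (Fin k)} (hdisj' : ArcDisjoint F') {Y : Finset A}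
    (h : ∀ i ∈ K, ∀ a ∈ (F' i).arcs, a ∉ (F i).arcs → D.tail a = x → a ∈ Y) :
    ∑ i ∈ K, D.outDegree (F' i).arcs x ≤ ∑ i ∈ K, D.outDegree (F i).arcs x + Y.card := by
  have h1 : ∀ i ∈ K, D.outDegree (F' i).arcs x ≤
      D.outDegree (F i).arcs x + ((F' i).arcs ∩ Y).card := by
    intro i hi
    refine (Finset.card_le_card fun a ha => ?_).trans (Finset.card_union_le _ _)
    obtain ⟨ha, hax⟩ := Finset.mem_filter.1 ha
    by_cases haF : a ∈ (F i).arcs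
    · exact Finset.mem_union_left _ (Finset.mem_filter.2 ⟨haF, hax⟩)
    · exact Finset.mem_union_right _ (Finset.mem_inter.2 ⟨ha, h i hi a ha haF hax⟩)
  refine (Finset.sum_le_sum h1).trans ?_
  rw [Finset.sum_add_distrib, ← Finset.card_biUnion]
  · refine Nat.add_le_add_left (Finset.card_le_card fun a ha => ?_) _
    obtain ⟨i, -, ha⟩ := Finset.mem_biUnion.1 ha
    exact (Finset.mem_inter.1 ha).2
  · intro i _ j _ hij
    exact (hdisj' hij).mono Finset.inter_subset_left Finset.inter_subset_left

end Extension

end Subdigraph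

end MultiDigraph

open MultiDigraph MultiDigraph.Subdigraph

/-- The vertex set `V + x` of `D` is `W`, so a subset of `V` is a finset of `W` without `x`. -/
theorem theorem1p8 {W A : Type*} [Fintype W] [DecidableEq W] [Fintype A] [DecidableEq A]
    (D : MultiDigraph W A) (x : W) (k l : ℕ) (hk : 0 < k)
    (I : Fin l → Finset (Fin k)) (hI : IsIndexPartition I) (c' : Fin l → ℕ)
    (F : Fin k → D.Subdigraph) (hF : ∀ i, (F i).IsArborescence x)
    (hdisj : MultiDigraph.Subdigraph.ArcDisjoint F)
    (hdeg : ∀ α, ∑ i ∈ I α, D.outDegree (F i).arcs x ≤ c' α) :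
    (∃ F' : Fin k → D.Subdigraph,
        (∀ i, (F' i).IsArborescence x ∧ (F' i).IsSpanning ∧ (F i).IsSubdigraphOf (F' i)) ∧
        MultiDigraph.Subdigraph.ArcDisjoint F' ∧
        ∀ α, ∑ i ∈ I α, D.outDegree (F' i).arcs x ≤ c' α) ↔
      (∀ X : Finset W, x ∉ X → X.Nonempty →
        (MultiDigraph.Subdigraph.missing F Finset.univ X).card ≤
          D.inDegree (MultiDigraph.Subdigraph.freeArcs F) X) ∧
      (∀ (t : ℕ) (X : Fin t → Finset W),
        (∀ j, x ∉ X j) → (∀ j, (X j).Nonempty) → (Pairwise fun i j => Disjoint (X i) (X j)) →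
        ∀ J : Finset (Fin k), (∃ S : Finset (Fin l), J = S.biUnion I) →
          ∑ j, (((MultiDigraph.Subdigraph.missing F J (X j)).card : ℤ) -
              (D.inDegree (MultiDigraph.Subdigraph.freeArcsAvoiding F x) (X j) : ℤ)) ≤
            ∑ α ∈ Finset.univ.filter (fun α => I α ⊆ J),
              ((c' α : ℤ) - ∑ i ∈ I α, (D.outDegree (F i).arcs x : ℤ))) := by
  constructor
  · rintro ⟨F', hF', hdisj', hdeg'⟩
    refine ⟨fun X hx hX => missing_le_of_extension hF' hdisj' hx hX, ?_⟩
    rintro t X hx hX hXd J ⟨S, rfl⟩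
    rw [filter_subset_biUnion hI]
    exact sum_missing_le_of_extension hI hF' hdisj' hdeg' hx hX hXd S
  · rintro ⟨hd, hc⟩
    choose blk hblk using hI.2.2
    have hblk' : ∀ i α, i ∈ I α ↔ blk i = α := by
      refine fun i α => ⟨fun hi => ?_, fun h => h ▸ hblk i⟩
      by_contra hne
      exact Finset.disjoint_left.1 (hI.2.1 hne) (hblk i) hi
    have hpack := demand_packingBound hI hblk' hF hc
    have harc := demand_arcBound (blk := blk) hF hd
    obtain ⟨e, he1, he2⟩ := Rect.exists_assignment (demand_supermodular (F := F) (x := x) (blk := blk))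
      hpack harc
    have hcut := cutCondition_of_assignment (F := F) (x := x) (blk := blk) (e := e)
      fun z hz => by convert he2 z hz
    obtain ⟨F', hF', hdisj', hnew⟩ := exists_spanning_of_cutCondition blk e _ F hF hdisj
      (by
        intro a ha
        rcases Finset.mem_union.1 ha with ha | ha
        · exact (mem_freeArcsAvoiding.1 ha).1
        · exact mem_freeArcs.1 (Finset.mem_filter.1 (Finset.mem_filter.1 ha).1).1)
      (by
        intro a ha hax
        rcases Finset.mem_union.1 ha with ha | ha
        · exact ((mem_freeArcsAvoiding.1 ha).2 hax).elim
        · exact (Finset.mem_filter.1 ha).2)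
      hcut
    refine ⟨F', hF', hdisj', fun α => ?_⟩
    -- All root arcs gained in block `α` were assigned to `α`, so they fit the remaining capacity.
    have h1 := sum_outDegree_le (F := F) (x := x) (K := I α) hdisj'
      (Y := (D.outArcs (freeArcs F) x).filter (fun a => e a = some α)) (by
        intro i hi a ha haF hax
        obtain ⟨haB, hea⟩ := hnew i a ha haF
        have hea' := hea hax
        rw [(hblk' i α).1 hi] at hea'
        rcases Finset.mem_union.1 haB with h | h
        · exact ((mem_freeArcsAvoiding.1 h).2 hax).elim
        · exact Finset.mem_filter.2 ⟨(Finset.mem_filter.1 h).1, hea'⟩)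
    have h2 := he1 α
    have h3 : ((∑ i ∈ I α, D.outDegree (F i).arcs x : ℕ) : ℤ) =
        ∑ i ∈ I α, (D.outDegree (F i).arcs x : ℤ) := by push_cast; rfl
    omega
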